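/- Let $A\in\mathbb R^{m\times n}$, $B\in\mathbb R^{\nu\times n}$, $\sigma>0$, and let $S\in\mathbb R^{n\times n}$ be symmetric positive semidefinite. Let $\mathcal X\subset\mathbb R^n$ be an ellitope, $$\mathcal X=\{x=Py:\ y\in\mathbb R^{\bar n},\ \exists t\in\mathcal T:\ y^TS_ky\le t_k,\ 1\le k\le K\},$$ where $P\in\mathbb R^{n\times\bar n}$, the $\bar n\times\bar n$ matrices $S_k\succeq0$ satisfy $\sum_kS_k\succ0$, and $\mathcal T\subset\mathbb R^K_+$ is a convex compact set that contains a vector with all entries positive and is monotone ($0\le s\le t$ and $t\in\mathcal T$ imply $s\in\mathcal T$). Assume $BP\neq0$, and put $\bar A=AP$, $\bar B=BP$, $\bar S=P^TSP$ (so that these are $A,B,S$ when $P=I$). One observes $\omega=Ax+\sigma\xi$ with $\xi\sim\mathcal N(0,I_m)$ and unknown $x\in\mathcal X$. The $S$-risk of a Borel estimate $\widehat w:\mathbb R^m\to\mathbb R^\nu$ of $Bx$ is $$\mathrm{RiskS}[\widehat w|\mathcal X]=\inf\{\sqrt\tau:\ \tau\ge 0,\ \mathbf E\|\widehat w(Ax+\sigma\xi)-Bx\|_2^2\le\tau(1+x^TSx)\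 \ \forall x\in\mathcal X\},$$ with $\inf\emptyset=\infty$, and the minimax $S$-risk $\mathrm{RiskS}_{\rm opt}[\mathcal X]$ is the infimum of $\mathrm{RiskS}[\widehat w|\mathcal X]$ over all Borel $\widehat w$. Consider the convex program in $\tau\in\mathbb R$, $H\in\mathbb R^{m\times\nu}$, $\lambda\in\mathbb R^K$ $$\min_{\tau,H,\lambda}\Big\{\tau:\ \begin{bmatrix}\sum_k\lambda_kS_k+\tau \bar S&\bar B^T-\bar A^TH\\ \bar B-H^T\bar A&I_\nu\end{bmatrix}\succeq0,\ \sigma^2\mathrm{Tr}(H^TH)+\max_{t\in\mathcal T}\lambda^Tt\le\tau,\ \lambda\ge0\Big\},$$ and let $$M_*=\Big(\max\{\mathrm{Tr}(\bar BQ\bar B^T):\ Q\succeq0,\ \exists t\in\mathcal T:\ \mathrm{Tr}(QS_k)\le t_k,\ 1\le k\le K\}\Big)^{1/2}.$$ Then the program is solvable, the maximum that defines $M_*$ is attained, $0<\mathrm{RiskS}_{\rm opt}[\mathcal X]<\infty$, and for every optimal solution $(\tau_*,H_*,\lambda_*)$ of the program the linear estimate $\widehat w_{H_*}(\omega)=H_*^T\omega$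 satisfies $$\mathrm{RiskS}[\widehat w_{H_*}|\mathcal X]\le\sqrt{6\ln\Big(\frac{8KM_*^2}{\mathrm{RiskS}_{\rm opt}^2[\mathcal X]}\Big)}\ \mathrm{RiskS}_{\rm opt}[\mathcal X].$$ -/

import Mathlib

open MeasureTheory ProbabilityTheory Matrix
open scoped ENNReal

noncomputable section

/-- The requirements on the data `[{S_k}, 𝒯]` of an ellitopic representation: `S_k ⪰ 0`,
`∑ S_k ≻ 0`, and `𝒯` is a convex compact monotone subset of `ℝ₊^K` which meets the interior
of `ℝ₊^K`. -/
structure IsEllitopicData {N K : ℕ} (Sk : Fin K → Matrix (Fin N) (Fin N) ℝ)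
    (T : Set (Fin K → ℝ)) : Prop where
  posSemidef : ∀ k, (Sk k).PosSemidef
  posDef_sum : (∑ k, Sk k).PosDef
  convex : Convex ℝ T
  isCompact : IsCompact T
  nonneg : ∀ t ∈ T, ∀ k, 0 ≤ t k
  meets_interior : ∃ t ∈ T, ∀ k, 0 < t k
  monotone : ∀ t ∈ T, ∀ s : Fin K → ℝ, (∀ k, 0 ≤ s k) → (∀ k, s k ≤ t k) → s ∈ T

/-- The set `{x : ∃ y, ∃ t ∈ 𝒯, x = P y, yᵀ S_k y ≤ t_k for all k}`. -/
def ellitope {n N K : ℕ} (P : Matrix (Fin n) (Fin N) ℝ)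
    (Sk : Fin K → Matrix (Fin N) (Fin N) ℝ) (T : Set (Fin K → ℝ)) : Set (Fin n → ℝ) :=
  {x | ∃ y : Fin N → ℝ, ∃ t ∈ T, x = P *ᵥ y ∧ ∀ k, y ⬝ᵥ (Sk k *ᵥ y) ≤ t k}

/-- The standard Gaussian distribution `𝒩(0, I_m)` on `ℝ^m`. -/
def stdNormal (m : ℕ) : Measure (Fin m → ℝ) :=
  Measure.pi fun _ => gaussianReal 0 1

/-- The expected squared Euclidean error `E ‖ŵ(A x + σ ξ) - B x‖₂²`, `ξ ∼ 𝒩(0, I_m)`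
(possibly `∞`). -/
def meanSqError {n m ν : ℕ} (A : Matrix (Fin m) (Fin n) ℝ) (B : Matrix (Fin ν) (Fin n) ℝ)
    (σ : ℝ) (what : (Fin m → ℝ) → (Fin ν → ℝ)) (x : Fin n → ℝ) : ℝ≥0∞ :=
  ∫⁻ ξ, ENNReal.ofReal (∑ i, (what (A *ᵥ x + σ • ξ) i - (B *ᵥ x) i) ^ 2) ∂(stdNormal m)

/-- The `S`-risk of the estimate `ŵ` on `X`: the infimum of `√τ` over the `τ ≥ 0` with
`E ‖ŵ(A x + σ ξ) - B x‖₂² ≤ τ (1 + xᵀ S x)` for all `x ∈ X` (it is `∞` if there is none). -/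
def riskS {n m ν : ℕ} (A : Matrix (Fin m) (Fin n) ℝ) (B : Matrix (Fin ν) (Fin n) ℝ)
    (S : Matrix (Fin n) (Fin n) ℝ) (σ : ℝ) (X : Set (Fin n → ℝ))
    (what : (Fin m → ℝ) → (Fin ν → ℝ)) : ℝ≥0∞ :=
  ⨅ (τ : ℝ) (_ : 0 ≤ τ ∧ ∀ x ∈ X,
    meanSqError A B σ what x ≤ ENNReal.ofReal (τ * (1 + x ⬝ᵥ (S *ᵥ x)))),
    ENNReal.ofReal (Real.sqrt τ)

/-- The minimax `S`-risk on `X`: the infimum of the `S`-risk over all Borel estimates. -/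
def riskSOpt {n m ν : ℕ} (A : Matrix (Fin m) (Fin n) ℝ) (B : Matrix (Fin ν) (Fin n) ℝ)
    (S : Matrix (Fin n) (Fin n) ℝ) (σ : ℝ) (X : Set (Fin n → ℝ)) : ℝ≥0∞ :=
  ⨅ (what : (Fin m → ℝ) → (Fin ν → ℝ)) (_ : Measurable what), riskS A B S σ X what

/-- The linear estimate `ŵ_H(ω) = Hᵀ ω`. -/
def linearEstimate {m ν : ℕ} (H : Matrix (Fin m) (Fin ν) ℝ) (ω : Fin m → ℝ) : Fin ν → ℝ :=
  Hᵀ *ᵥ ω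

/-- The support function `φ_𝒯(λ) = max_{t ∈ 𝒯} λᵀ t`. -/
def supportFn {K : ℕ} (T : Set (Fin K → ℝ)) (lam : Fin K → ℝ) : ℝ :=
  sSup ((fun t => lam ⬝ᵥ t) '' T)

/-- Feasibility of `(τ, H, λ)` for the convex design program: minimize `τ` subject to
`[∑ λ_k S_k + τ S, Bᵀ - Aᵀ H; B - Hᵀ A, I_ν] ⪰ 0`, `σ² Tr(Hᵀ H) + φ_𝒯(λ) ≤ τ`, `λ ≥ 0`. -/
structure DesignFeasible {N m ν K : ℕ} (A : Matrix (Fin m) (Fin N) ℝ)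
    (B : Matrix (Fin ν) (Fin N) ℝ) (S : Matrix (Fin N) (Fin N) ℝ) (σ : ℝ)
    (Sk : Fin K → Matrix (Fin N) (Fin N) ℝ) (T : Set (Fin K → ℝ))
    (τ : ℝ) (H : Matrix (Fin m) (Fin ν) ℝ) (lam : Fin K → ℝ) : Prop where
  lmi : (fromBlocks (∑ k, lam k • Sk k + τ • S) (Bᵀ - Aᵀ * H) (B - Hᵀ * A)
    (1 : Matrix (Fin ν) (Fin ν) ℝ)).PosSemidef
  bound : σ ^ 2 * (Hᵀ * H).trace + supportFn T lam ≤ τ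
  nonneg : ∀ k, 0 ≤ lam k

/-- `(τ, H, λ)` is an optimal solution of the design program. -/
def DesignOptimal {N m ν K : ℕ} (A : Matrix (Fin m) (Fin N) ℝ)
    (B : Matrix (Fin ν) (Fin N) ℝ) (S : Matrix (Fin N) (Fin N) ℝ) (σ : ℝ)
    (Sk : Fin K → Matrix (Fin N) (Fin N) ℝ) (T : Set (Fin K → ℝ))
    (τ : ℝ) (H : Matrix (Fin m) (Fin ν) ℝ) (lam : Fin K → ℝ) : Prop :=
  DesignFeasible A B S σ Sk T τ H lam ∧
    ∀ (τ' : ℝ) (H' : Matrix (Fin m) (Fin ν) ℝ) (lam' : Fin K → ℝ),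
      DesignFeasible A B S σ Sk T τ' H' lam' → τ ≤ τ'

/-- The values `Tr(B Q Bᵀ)` over `𝒬 = {Q ⪰ 0 : ∃ t ∈ 𝒯, Tr(Q S_k) ≤ t_k for all k}`. -/
def traceValues {N ν K : ℕ} (B : Matrix (Fin ν) (Fin N) ℝ)
    (Sk : Fin K → Matrix (Fin N) (Fin N) ℝ) (T : Set (Fin K → ℝ)) : Set ℝ :=
  (fun Q : Matrix (Fin N) (Fin N) ℝ => (B * Q * Bᵀ).trace) ''
    {Q | Q.PosSemidef ∧ ∃ t ∈ T, ∀ k, (Q * Sk k).trace ≤ t k}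

/-- `M_* = √(max_{Q ∈ 𝒬} Tr(B Q Bᵀ))`. -/
def Mstar {N ν K : ℕ} (B : Matrix (Fin ν) (Fin N) ℝ)
    (Sk : Fin K → Matrix (Fin N) (Fin N) ℝ) (T : Set (Fin K → ℝ)) : ℝ :=
  Real.sqrt (sSup (traceValues B Sk T))

end

/-! ### Positive semidefinite matrices: quadratic forms, traces, compactness. -/

section Matrices

variable {ι κ : Type*} [Fintype ι] [Fintype κ]

/-! Upper bound: the mean squared error of `Hᵀ ω` splits exactly into squared bias and variance, and
the constraints of the design program bound this sum, so an optimal design has risk at most `√τ`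
(`DesignFeasible.riskS_le`). It remains to bound the optimal value `τ` by `6 L R`, where `R` is the
squared minimax risk and `L` the logarithm in the claim.

Lower bound: minimax duality turns the optimality of `τ` into a covariance `Q`, admissible in the
definition of `M_*`, under which every linear estimate has Bayesian risk at least `τ (1 + Tr(Q S))`
(`exists_leastFavorable`). In the Gaussian model a suitable linear estimate is Bayes optimal, so
nonlinear estimates do no better (`exists_linearCost_le_bayesRisk`). A draw from `𝒩(0, Q)` satisfies
the ellitope constraints only on average, so the prior is shrunk to `𝒩(0, δ Q)`: the Bayesian bound
loses at most the factor `δ`, while each of the `K` constraints fails with probability of order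
`exp(-1/(3δ))`. When they all hold, the risk bound applies. When one fails, the estimate, truncated
to the ball of radius `M_*`, has squared error at most `2 M_*² + 2 ‖B x‖²`, and the expectation of
this over the failure event is controlled by `exists_tail_majorant`. Hence (`mul_value_le`) `δ τ ≤ R
+ K exp(-1/(3δ)) √3 (2 + 12 δ) M_*²`.

The choice `δ = 1/(3L)` makes the last term at most `R` (`value_le_of_forall_delta`). Since `τ > 0`,
a small `δ` in the same inequality also shows `R > 0` (`exists_delta_tail_lt`). -/

theorem Matrix.posSemidef_iff_real {M : Matrix ι ι ℝ} :
    M.PosSemidef ↔ Mᵀ = M ∧ ∀ x : ι → ℝ, 0 ≤ x ⬝ᵥ (M *ᵥ x) := by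
  rw [posSemidef_iff_dotProduct_mulVec, IsHermitian, conjTranspose_eq_transpose_of_trivial]
  simp

theorem Matrix.PosSemidef.quadForm_nonneg {M : Matrix ι ι ℝ} (hM : M.PosSemidef) (x : ι → ℝ) :
    0 ≤ x ⬝ᵥ (M *ᵥ x) :=
  (posSemidef_iff_real.1 hM).2 x

theorem Matrix.PosSemidef.exists_eq_mul_transpose [DecidableEq ι] {Q : Matrix ι ι ℝ}
    (hQ : Q.PosSemidef) :
    ∃ C : Matrix ι ι ℝ, Q = C * Cᵀ := by
  open scoped MatrixOrder in
  obtain ⟨B, hB⟩ := CStarAlgebra.nonneg_iff_eq_star_mul_self.mp hQ.nonneg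
  exact ⟨Bᵀ, by simpa [star_eq_conjTranspose] using hB⟩

theorem Matrix.posSemidef_mul_transpose_self (E : Matrix κ ι ℝ) : (E * Eᵀ).PosSemidef := by
  simpa using posSemidef_self_mul_conjTranspose E

theorem Matrix.PosSemidef.mul_mul_transpose {Q : Matrix ι ι ℝ} (hQ : Q.PosSemidef)
    (E : Matrix κ ι ℝ) : (E * Q * Eᵀ).PosSemidef := by
  simpa using hQ.mul_mul_conjTranspose_same E

theorem Matrix.PosSemidef.trace_mul_nonneg [DecidableEq ι] {Q M : Matrix ι ι ℝ}
    (hQ : Q.PosSemidef) (hM : M.PosSemidef) : 0 ≤ (Q * M).trace := by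
  obtain ⟨C, rfl⟩ := hM.exists_eq_mul_transpose
  have h := (hQ.mul_mul_transpose Cᵀ).trace_nonneg
  rwa [transpose_transpose, trace_mul_cycle, trace_mul_comm] at h

theorem Matrix.trace_vecMulVec_mul (x : ι → ℝ) (M : Matrix ι ι ℝ) :
    (vecMulVec x x * M).trace = x ⬝ᵥ (M *ᵥ x) := by
  rw [trace_mul_comm, mul_vecMulVec, trace_vecMulVec, dotProduct_comm]

theorem Matrix.posSemidef_vecMulVec (x : ι → ℝ) : (vecMulVec x x).PosSemidef := by
  simpa using posSemidef_vecMulVec_self_star x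

theorem Matrix.dotProduct_mulVec_self (E : Matrix κ ι ℝ) (x : ι → ℝ) :
    (E *ᵥ x) ⬝ᵥ (E *ᵥ x) = x ⬝ᵥ ((Eᵀ * E) *ᵥ x) := by
  rw [← mulVec_mulVec, dotProduct_mulVec x, vecMul_transpose]

theorem Matrix.quadForm_sum {K : Type*} [Fintype K] (c : K → ℝ) (M : K → Matrix ι ι ℝ)
    (x : ι → ℝ) :
    x ⬝ᵥ ((∑ k, c k • M k) *ᵥ x) = ∑ k, c k * (x ⬝ᵥ (M k *ᵥ x)) := by
  rw [sum_mulVec, dotProduct_sum]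
  simp [smul_mulVec]

/-- The gap between the two sides is exactly `a b Tr((X - Y) Q (X - Y)ᵀ)`. -/
theorem Matrix.trace_quadratic_convex [DecidableEq ι] {Q : Matrix ι ι ℝ} (hQ : Q.PosSemidef)
    (X Y : Matrix κ ι ℝ) {a b : ℝ} (ha : 0 ≤ a) (hb : 0 ≤ b) (hab : a + b = 1) :
    ((a • X + b • Y) * Q * (a • X + b • Y)ᵀ).trace ≤
      a * (X * Q * Xᵀ).trace + b * (Y * Q * Yᵀ).trace := by
  have h := (hQ.mul_mul_transpose (X - Y)).trace_nonneg
  have hab' : 0 ≤ a * b := mul_nonneg ha hb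
  have h2 := mul_nonneg hab' h
  obtain rfl : b = 1 - a := by linarith
  simp only [transpose_add, transpose_smul, transpose_sub, Matrix.add_mul, Matrix.mul_add,
    Matrix.sub_mul, Matrix.mul_sub, trace_add, trace_sub, trace_smul, smul_mul, Matrix.mul_smul,
    smul_eq_mul] at h2 ⊢
  linarith

theorem Matrix.isClosed_posSemidef : IsClosed {M : Matrix ι ι ℝ | M.PosSemidef} := by
  simp only [posSemidef_iff_real, Set.ofPred_and, Set.ofPred_forall]
  refine IsClosed.inter (isClosed_eq (by fun_prop) (by fun_prop)) (isClosed_iInter fun x => ?_)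
  exact isClosed_le (by fun_prop) (by fun_prop)

theorem Matrix.convex_posSemidef {α : Type*} : Convex ℝ {M : Matrix α α ℝ | M.PosSemidef} :=
  fun _ hx _ hy _ _ ha hb _ => (PosSemidef.smul hx ha).add (PosSemidef.smul hy hb)

/-- The constant is the minimum of the form over the Euclidean unit sphere; homogeneity does the
rest. -/
theorem Matrix.PosDef.exists_coercive {M : Matrix ι ι ℝ} (hM : M.PosDef) :
    ∃ c : ℝ, 0 < c ∧ ∀ x : ι → ℝ, c * (x ⬝ᵥ x) ≤ x ⬝ᵥ (M *ᵥ x) := by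
  classical
  rcases isEmpty_or_nonempty ι with h | h
  · exact ⟨1, one_pos, fun x => by simp [dotProduct]⟩
  let K : Set (ι → ℝ) := {x | x ⬝ᵥ x = 1}
  have hKc : IsCompact K := by
    refine Metric.isCompact_of_isClosed_isBounded
      (isClosed_eq (by fun_prop) (by fun_prop)) ?_
    refine Metric.isBounded_iff_subset_closedBall 0 |>.2 ⟨1, fun x hx => ?_⟩
    rw [mem_closedBall_zero_iff, pi_norm_le_iff_of_nonneg zero_le_one]
    intro i
    have h1 : x i * x i ≤ ∑ j, x j * x j :=
      Finset.single_le_sum (f := fun j => x j * x j) (fun j _ => mul_self_nonneg _)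
        (Finset.mem_univ i)
    have h2 : x i * x i ≤ 1 := h1.trans_eq hx
    rw [Real.norm_eq_abs]
    exact abs_le_one_iff_mul_self_le_one.2 h2
  have hne : K.Nonempty := ⟨Pi.single h.some 1, by simp [K]⟩
  obtain ⟨x₀, hx₀, hmin⟩ := hKc.exists_isMinOn hne
    (f := fun x => x ⬝ᵥ (M *ᵥ x)) (by fun_prop)
  have hx0 : x₀ ≠ 0 := by
    rintro rfl
    simp [K] at hx₀
  refine ⟨x₀ ⬝ᵥ (M *ᵥ x₀), by simpa using hM.dotProduct_mulVec_pos hx0, fun x => ?_⟩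
  rcases eq_or_ne x 0 with rfl | hx
  · simp
  have hpos : 0 < x ⬝ᵥ x := by simpa using dotProduct_star_self_pos_iff.2 hx
  set s := Real.sqrt (x ⬝ᵥ x) with hs
  have hs2 : s * s = x ⬝ᵥ x := Real.mul_self_sqrt hpos.le
  have hspos : 0 < s := Real.sqrt_pos.2 hpos
  have hmem : s⁻¹ • x ∈ K := by
    simp only [K, Set.mem_ofPred_eq, smul_dotProduct, dotProduct_smul, smul_eq_mul, ← hs2]
    field_simp
  have := hmin hmem
  simp only [Set.mem_ofPred_eq, mulVec_smul, smul_dotProduct, dotProduct_smul, smul_eq_mul] at this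
  rw [← hs2]
  calc _ ≤ (s⁻¹ * (s⁻¹ * x ⬝ᵥ M *ᵥ x)) * (s * s) := by gcongr
    _ = _ := by field_simp

theorem Matrix.exists_quadForm_le (M : Matrix ι ι ℝ) :
    ∃ c : ℝ, 0 ≤ c ∧ ∀ x : ι → ℝ, x ⬝ᵥ (M *ᵥ x) ≤ c * (x ⬝ᵥ x) := by
  refine ⟨∑ i, ∑ j, |M i j|, by positivity, fun x => ?_⟩
  simp only [dotProduct, mulVec, Finset.mul_sum, Finset.sum_mul]
  rw [Finset.sum_comm (s := Finset.univ) (t := Finset.univ)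
    (f := fun l i => ∑ j, |M i j| * (x l * x l))]
  refine Finset.sum_le_sum fun i _ => ?_
  rw [Finset.sum_comm]
  refine Finset.sum_le_sum fun j _ => ?_
  rw [← Finset.mul_sum]
  have h1 : ∀ i, x i * x i ≤ ∑ l, x l * x l := fun i =>
    Finset.single_le_sum (f := fun l => x l * x l) (fun l _ => mul_self_nonneg _)
      (Finset.mem_univ i)
  have h2 : |x i * x j| ≤ ∑ l, x l * x l := by
    rw [abs_le]
    constructor <;> nlinarith [h1 i, h1 j, sq_nonneg (x i + x j), sq_nonneg (x i - x j)]
  calc x i * (M i j * x j) = M i j * (x i * x j) := by ring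
    _ ≤ |M i j * (x i * x j)| := le_abs_self _
    _ = |M i j| * |x i * x j| := abs_mul _ _
    _ ≤ _ := by gcongr

theorem Matrix.PosDef.exists_quadForm_le_mul {M : Matrix ι ι ℝ} (hM : M.PosDef)
    (G : Matrix ι ι ℝ) :
    ∃ c : ℝ, 0 ≤ c ∧ ∀ x : ι → ℝ, x ⬝ᵥ (G *ᵥ x) ≤ c * (x ⬝ᵥ (M *ᵥ x)) := by
  obtain ⟨a, ha, h1⟩ := hM.exists_coercive
  obtain ⟨b, hb, h2⟩ := exists_quadForm_le G
  refine ⟨b / a, by positivity, fun x => (h2 x).trans ?_⟩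
  rw [div_mul_eq_mul_div, le_div_iff₀ ha]
  nlinarith [mul_le_mul_of_nonneg_left (h1 x) hb]

/-- Since `M ⪰ c I` with `c > 0`, the trace of `Q` is bounded; testing `Q` on `e_i ± e_j` then
bounds every entry by the trace. -/
theorem Matrix.isCompact_posSemidef_trace_le [DecidableEq ι] {M : Matrix ι ι ℝ} (hM : M.PosDef)
    (r : ℝ) :
    IsCompact {Q : Matrix ι ι ℝ | Q.PosSemidef ∧ (Q * M).trace ≤ r} := by
  have hcl : IsClosed {Q : Matrix ι ι ℝ | Q.PosSemidef ∧ (Q * M).trace ≤ r} :=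
    isClosed_posSemidef.inter
      (isClosed_le (f := fun Q : Matrix ι ι ℝ => (Q * M).trace) (by fun_prop) continuous_const)
  obtain ⟨c, hc, hcM⟩ := hM.exists_coercive
  have key : ∀ Q : Matrix ι ι ℝ, Q.PosSemidef → (Q * M).trace ≤ r → ∀ i j, |Q i j| ≤ |r| / c := by
    intro Q hQ hr i j
    have hMc : (M - c • 1).PosSemidef := by
      refine posSemidef_iff_real.2 ⟨?_, fun x => ?_⟩
      · have := hM.isHermitian
        rw [IsHermitian, conjTranspose_eq_transpose_of_trivial] at this
        simp [this]
      · simp only [sub_mulVec, smul_mulVec, one_mulVec, dotProduct_sub, dotProduct_smul,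
          smul_eq_mul]
        linarith [hcM x]
    have h1 := hQ.trace_mul_nonneg hMc
    simp only [Matrix.mul_sub, Matrix.mul_smul, Matrix.mul_one, trace_sub, trace_smul,
      smul_eq_mul] at h1
    have htr : Q.trace ≤ |r| / c := by
      rw [le_div_iff₀ hc]
      linarith [le_abs_self r]
    have hd : ∀ i, Q i i ≤ Q.trace := fun i =>
      Finset.single_le_sum (f := fun i => Q i i) (fun i _ => hQ.diag_nonneg) (Finset.mem_univ i)
    have hsymm : Q j i = Q i j := congrFun (congrFun (posSemidef_iff_real.1 hQ).1 i) j
    have hp := hQ.quadForm_nonneg (Pi.single i 1 + Pi.single j 1)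
    have hm := hQ.quadForm_nonneg (Pi.single i 1 - Pi.single j 1)
    simp only [mulVec_add, mulVec_sub, mulVec_single_one, add_dotProduct, sub_dotProduct,
      single_one_dotProduct, Pi.add_apply, Pi.sub_apply, col_apply] at hp hm
    rw [abs_le]
    constructor <;> linarith [hd i, hd j]
  refine Metric.isCompact_of_isClosed_isBounded (α := ι → ι → ℝ) hcl ?_
  refine Metric.isBounded_iff_subset_closedBall 0 |>.2 ⟨|r| / c, fun Q hQ => ?_⟩
  have hrc : 0 ≤ |r| / c := by positivity
  rw [mem_closedBall_zero_iff, pi_norm_le_iff_of_nonneg hrc]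
  intro i
  rw [pi_norm_le_iff_of_nonneg hrc]
  exact fun j => key Q hQ.1 hQ.2 i j

end Matrices

/-! ### The design program and the trace maximum: solvability and positivity. -/

section Program

variable {N m ν K : ℕ} {A : Matrix (Fin m) (Fin N) ℝ} {B : Matrix (Fin ν) (Fin N) ℝ}
  {S : Matrix (Fin N) (Fin N) ℝ} {σ : ℝ} {Sk : Fin K → Matrix (Fin N) (Fin N) ℝ}
  {T : Set (Fin K → ℝ)}

theorem IsEllitopicData.nonempty (hX : IsEllitopicData Sk T) : T.Nonempty :=
  let ⟨t, ht, _⟩ := hX.meets_interior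
  ⟨t, ht⟩

theorem IsEllitopicData.supportFn_le_iff (hX : IsEllitopicData Sk T) (lam : Fin K → ℝ) (c : ℝ) :
    supportFn T lam ≤ c ↔ ∀ t ∈ T, lam ⬝ᵥ t ≤ c := by
  have hb : BddAbove ((fun t => lam ⬝ᵥ t) '' T) :=
    (hX.isCompact.image (by fun_prop)).bddAbove
  rw [supportFn, csSup_le_iff hb (hX.nonempty.image _)]
  simp

theorem IsEllitopicData.exists_sum_le (hX : IsEllitopicData Sk T) :
    ∃ r : ℝ, 0 < r ∧ ∀ t ∈ T, ∑ k, t k ≤ r := by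
  obtain ⟨r, hr⟩ := (hX.isCompact.image
    (f := fun t : Fin K → ℝ => ∑ k, t k) (by fun_prop)).bddAbove
  exact ⟨max r 1, by positivity, fun t ht =>
    (hr (Set.mem_image_of_mem _ ht)).trans (le_max_left _ _)⟩

theorem Matrix.quadForm_univ_sum (Sk : Fin K → Matrix (Fin N) (Fin N) ℝ) (x : Fin N → ℝ) :
    x ⬝ᵥ ((∑ k, Sk k) *ᵥ x) = ∑ k, x ⬝ᵥ (Sk k *ᵥ x) := by
  rw [Matrix.sum_mulVec, dotProduct_sum]

/-- Schur complement with respect to the identity block. In this form feasibility is a family of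
closed scalar conditions in `(τ, H, λ)`, convenient both for compactness and for checking
candidates. -/
theorem designFeasible_iff (hX : IsEllitopicData Sk T) (hS : S.PosSemidef) {τ : ℝ}
    {H : Matrix (Fin m) (Fin ν) ℝ} {lam : Fin K → ℝ} :
    DesignFeasible A B S σ Sk T τ H lam ↔
      (∀ y : Fin N → ℝ, ((B - Hᵀ * A) *ᵥ y) ⬝ᵥ ((B - Hᵀ * A) *ᵥ y) ≤
        ∑ k, lam k * (y ⬝ᵥ (Sk k *ᵥ y)) + τ * (y ⬝ᵥ (S *ᵥ y))) ∧
      (∀ t ∈ T, σ ^ 2 * (Hᵀ * H).trace + lam ⬝ᵥ t ≤ τ) ∧ ∀ k, 0 ≤ lam k := by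
  have h1 : (fromBlocks (∑ k, lam k • Sk k + τ • S) (Bᵀ - Aᵀ * H) (B - Hᵀ * A)
      (1 : Matrix (Fin ν) (Fin ν) ℝ)).PosSemidef ↔
      (∀ y : Fin N → ℝ, ((B - Hᵀ * A) *ᵥ y) ⬝ᵥ ((B - Hᵀ * A) *ᵥ y) ≤
        ∑ k, lam k * (y ⬝ᵥ (Sk k *ᵥ y)) + τ * (y ⬝ᵥ (S *ᵥ y))) := by
    have hE : B - Hᵀ * A = (Bᵀ - Aᵀ * H)ᴴ := by
      simp [conjTranspose_eq_transpose_of_trivial, transpose_sub, transpose_mul]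
    have hE' : Bᵀ - Aᵀ * H = (B - Hᵀ * A)ᵀ := by simp [transpose_sub, transpose_mul]
    have : Invertible (1 : Matrix (Fin ν) (Fin ν) ℝ) := invertibleOne
    rw [hE, PosDef.fromBlocks₂₂ _ _ PosDef.one, ← hE, hE', inv_one, Matrix.mul_one,
      posSemidef_iff_real]
    have hsymm : ∀ k, (Sk k)ᵀ = Sk k := fun k => (posSemidef_iff_real.1 (hX.posSemidef k)).1
    have hSs : Sᵀ = S := (posSemidef_iff_real.1 hS).1
    rw [and_iff_right]
    · refine forall_congr' fun y => ?_
      rw [sub_mulVec, dotProduct_sub, ← dotProduct_mulVec_self, sub_nonneg, add_mulVec,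
        dotProduct_add, quadForm_sum, smul_mulVec, dotProduct_smul, smul_eq_mul]
    · simp [transpose_sub, transpose_add, transpose_sum, transpose_smul, transpose_mul, hsymm, hSs]
  have h2 : σ ^ 2 * (Hᵀ * H).trace + supportFn T lam ≤ τ ↔
      ∀ t ∈ T, σ ^ 2 * (Hᵀ * H).trace + lam ⬝ᵥ t ≤ τ := by
    rw [← le_sub_iff_add_le', hX.supportFn_le_iff]
    simp only [le_sub_iff_add_le']
  exact ⟨fun h => ⟨h1.1 h.lmi, h2.1 h.bound, h.nonneg⟩, fun h => ⟨h1.2 h.1, h2.2 h.2.1, h.2.2⟩⟩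

theorem Matrix.trace_transpose_mul_self_nonneg (H : Matrix (Fin m) (Fin ν) ℝ) :
    0 ≤ (Hᵀ * H).trace := by
  simpa using (posSemidef_mul_transpose_self Hᵀ).trace_nonneg

theorem dotProduct_nonneg_of_mem (hX : IsEllitopicData Sk T) {lam t : Fin K → ℝ}
    (hl : ∀ k, 0 ≤ lam k) (ht : t ∈ T) : 0 ≤ lam ⬝ᵥ t :=
  Finset.sum_nonneg fun k _ => mul_nonneg (hl k) (hX.nonneg t ht k)

theorem DesignFeasible.value_nonneg (hX : IsEllitopicData Sk T) (hS : S.PosSemidef) {τ : ℝ}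
    {H : Matrix (Fin m) (Fin ν) ℝ} {lam : Fin K → ℝ}
    (h : DesignFeasible A B S σ Sk T τ H lam) : 0 ≤ τ := by
  obtain ⟨-, h2, h3⟩ := (designFeasible_iff hX hS).1 h
  obtain ⟨t, ht⟩ := hX.nonempty
  have h1 := mul_nonneg (sq_nonneg σ) (trace_transpose_mul_self_nonneg H)
  linarith [h2 t ht, dotProduct_nonneg_of_mem hX h3 ht]

theorem Matrix.sq_le_trace (H : Matrix (Fin m) (Fin ν) ℝ) (i : Fin m) (j : Fin ν) :
    H i j ^ 2 ≤ (Hᵀ * H).trace := by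
  have h : (Hᵀ * H).trace = ∑ j, ∑ i, H i j ^ 2 := by
    simp [trace, mul_apply, sq]
  rw [h]
  exact (Finset.single_le_sum (f := fun i => H i j ^ 2) (fun _ _ => sq_nonneg _)
    (Finset.mem_univ i)).trans (Finset.single_le_sum (f := fun j => ∑ i, H i j ^ 2)
    (fun _ _ => Finset.sum_nonneg fun _ _ => sq_nonneg _) (Finset.mem_univ j))

/-- At value zero the variance term forces `H = 0`, a strictly positive `t ∈ 𝒯` forces `λ = 0`, and
the quadratic inequality then forces `B = 0`. -/
theorem DesignFeasible.value_pos (hσ : 0 < σ) (hX : IsEllitopicData Sk T) (hS : S.PosSemidef)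
    (hB : B ≠ 0) {τ : ℝ} {H : Matrix (Fin m) (Fin ν) ℝ} {lam : Fin K → ℝ}
    (h : DesignFeasible A B S σ Sk T τ H lam) : 0 < τ := by
  refine (h.value_nonneg hX hS).lt_of_ne' fun h0 => hB ?_
  subst h0
  obtain ⟨h1, h2, h3⟩ := (designFeasible_iff hX hS).1 h
  obtain ⟨t, ht, htpos⟩ := hX.meets_interior
  have hσ2 : 0 < σ ^ 2 := by positivity
  have hH := trace_transpose_mul_self_nonneg H
  have hl := dotProduct_nonneg_of_mem hX h3 ht
  have h2t := h2 t ht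
  have hH0 : H = 0 := by
    ext i j
    have : (Hᵀ * H).trace = 0 := by nlinarith
    have := (sq_le_trace H i j).trans_eq this
    simpa using le_antisymm this (sq_nonneg _)
  have hl0 : ∀ k, lam k = 0 := by
    intro k
    have h4 : lam ⬝ᵥ t ≤ 0 := by nlinarith
    have h5 : lam k * t k ≤ lam ⬝ᵥ t :=
      Finset.single_le_sum (f := fun k => lam k * t k)
        (fun k _ => mul_nonneg (h3 k) (htpos k).le) (Finset.mem_univ k)
    nlinarith [h3 k, htpos k]
  refine Matrix.ext_of_mulVec_single fun j => ?_
  have h6 := h1 (Pi.single j 1)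
  simp only [hH0, hl0, transpose_zero, Matrix.zero_mul, sub_zero, zero_mul,
    Finset.sum_const_zero, add_zero] at h6
  rw [zero_mulVec]
  refine dotProduct_star_self_eq_zero.1 ?_
  rw [star_trivial]
  refine le_antisymm h6 (Finset.sum_nonneg fun i _ => mul_self_nonneg _)

theorem exists_designFeasible (hX : IsEllitopicData Sk T) (hS : S.PosSemidef) :
    ∃ (τ : ℝ) (lam : Fin K → ℝ), DesignFeasible A B S σ Sk T τ 0 lam := by
  obtain ⟨c, hc, h⟩ := hX.posDef_sum.exists_quadForm_le_mul (Bᵀ * B)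
  obtain ⟨r, hr, hsum⟩ := hX.exists_sum_le
  -- With `H = 0`, equal multipliers `c` suffice because `BᵀB ⪯ c ∑ S_k`, and their support function
  -- is at most `c r`.
  refine ⟨c * r, fun _ => c, (designFeasible_iff hX hS).2 ⟨fun y => ?_, fun t ht => ?_,
    fun _ => hc⟩⟩
  · rw [transpose_zero, Matrix.zero_mul, sub_zero, dotProduct_mulVec_self]
    refine (h y).trans ?_
    rw [quadForm_univ_sum, ← Finset.mul_sum]
    have := hS.quadForm_nonneg y
    have : 0 ≤ c * r * (y ⬝ᵥ (S *ᵥ y)) := by positivity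
    linarith
  · simp only [dotProduct, ← Finset.mul_sum, Matrix.mul_zero, trace_zero, mul_zero, zero_add]
    exact mul_le_mul_of_nonneg_left (hsum t ht) hc

/-- Sublevel sets are compact: the variance term bounds `H`, and a strictly positive `t₀ ∈ 𝒯` bounds
each `λ_k` by `τ₀ / t₀ k`. -/
theorem exists_designOptimal (hσ : 0 < σ) (hX : IsEllitopicData Sk T) (hS : S.PosSemidef) :
    ∃ (τ : ℝ) (H : Matrix (Fin m) (Fin ν) ℝ) (lam : Fin K → ℝ),
      DesignOptimal A B S σ Sk T τ H lam := by
  obtain ⟨τ₀, lam₀, h₀⟩ := exists_designFeasible (A := A) (B := B) (σ := σ) hX hS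
  obtain ⟨t₀, ht₀, hpos⟩ := hX.meets_interior
  have hσ2 : 0 < σ ^ 2 := by positivity
  let F : Set (ℝ × Matrix (Fin m) (Fin ν) ℝ × (Fin K → ℝ)) :=
    {p | DesignFeasible A B S σ Sk T p.1 p.2.1 p.2.2 ∧ p.1 ≤ τ₀}
  let box : Set (Matrix (Fin m) (Fin ν) ℝ) :=
    Set.pi Set.univ fun _ => Set.pi Set.univ fun _ =>
      Set.Icc (-(1 + τ₀ / σ ^ 2)) (1 + τ₀ / σ ^ 2)
  have hbox : IsCompact box := isCompact_univ_pi fun _ => isCompact_univ_pi fun _ => isCompact_Icc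
  have hsub : F ⊆ Set.Icc 0 τ₀ ×ˢ box ×ˢ Set.Icc 0 (fun k => τ₀ / t₀ k) := by
    rintro ⟨τ, H, lam⟩ ⟨hf, hle⟩
    simp only at hf hle
    have hτ := hf.value_nonneg hX hS
    obtain ⟨-, h2, h3⟩ := (designFeasible_iff hX hS).1 hf
    have h2t := h2 t₀ ht₀
    refine ⟨⟨hτ, hle⟩, fun i _ j _ => ?_, fun k => h3 k, fun k => ?_⟩
    · have h4 : σ ^ 2 * H i j ^ 2 ≤ τ₀ := by
        have := mul_le_mul_of_nonneg_left (sq_le_trace H i j) hσ2.le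
        linarith [dotProduct_nonneg_of_mem hX h3 ht₀]
      have h5 : H i j ^ 2 ≤ τ₀ / σ ^ 2 := by
        rw [le_div_iff₀ hσ2]
        linarith
      -- The bound `|h| ≤ 1 + h²` avoids square roots in the box.
      refine abs_le.1 (?_ : |H i j| ≤ 1 + τ₀ / σ ^ 2)
      nlinarith [sq_abs (H i j), sq_nonneg (|H i j| - 1), abs_nonneg (H i j)]
    · have h5 : lam k * t₀ k ≤ lam ⬝ᵥ t₀ :=
        Finset.single_le_sum (f := fun k => lam k * t₀ k)
          (fun k _ => mul_nonneg (h3 k) (hpos k).le) (Finset.mem_univ k)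
      have := mul_nonneg hσ2.le (trace_transpose_mul_self_nonneg H)
      show lam k ≤ τ₀ / t₀ k
      rw [le_div_iff₀ (hpos k)]
      linarith
  have hcl : IsClosed F := by
    simp only [F, designFeasible_iff hX hS, Set.ofPred_and, Set.ofPred_forall]
    refine IsClosed.inter (IsClosed.inter (isClosed_iInter fun y => ?_) (IsClosed.inter
      (isClosed_iInter fun t => isClosed_iInter fun _ => ?_) (isClosed_iInter fun k => ?_))) ?_
    · exact isClosed_le (by fun_prop) (by fun_prop)
    · exact isClosed_le (by fun_prop) (by fun_prop)
    · exact isClosed_le (by fun_prop) (by fun_prop)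
    · exact isClosed_le (by fun_prop) (by fun_prop)
  have hF : IsCompact F := (isCompact_Icc.prod (hbox.prod isCompact_Icc)).of_isClosed_subset hcl hsub
  obtain ⟨p, hp, hmin⟩ := hF.exists_isMinOn ⟨(τ₀, 0, lam₀), h₀, le_rfl⟩
    (f := fun p => p.1) (by fun_prop)
  refine ⟨p.1, p.2.1, p.2.2, hp.1, fun τ' H' lam' h' => ?_⟩
  rcases le_total τ' τ₀ with h | h
  · exact hmin (a := (τ', H', lam')) ⟨h', h⟩
  · exact hp.2.trans h

/-- The set is the projection of a compact set of pairs `(Q, t)`: summing the constraints bounds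
`Tr(Q ∑ S_k)`, and `∑ S_k ≻ 0`. -/
theorem IsEllitopicData.isCompact_traceSet (hX : IsEllitopicData Sk T) :
    IsCompact {Q : Matrix (Fin N) (Fin N) ℝ |
      Q.PosSemidef ∧ ∃ t ∈ T, ∀ k, (Q * Sk k).trace ≤ t k} := by
  obtain ⟨r, hr, hsum⟩ := hX.exists_sum_le
  have hc := ((isCompact_posSemidef_trace_le hX.posDef_sum r).prod hX.isCompact).inter_right
    (t := {p | ∀ k, (p.1 * Sk k).trace ≤ p.2 k}) (by
      simp only [Set.ofPred_forall]
      exact isClosed_iInter fun k => isClosed_le (by fun_prop) (by fun_prop))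
  convert hc.image continuous_fst using 1
  ext Q
  constructor
  · rintro ⟨hQ, t, ht, h⟩
    refine ⟨(Q, t), ⟨⟨⟨hQ, ?_⟩, ht⟩, h⟩, rfl⟩
    rw [Finset.mul_sum, trace_sum]
    exact (Finset.sum_le_sum fun k _ => h k).trans (hsum t ht)
  · rintro ⟨⟨Q, t⟩, ⟨⟨⟨hQ, -⟩, ht⟩, h⟩, rfl⟩
    exact ⟨hQ, t, ht, h⟩

theorem IsEllitopicData.isGreatest_Mstar (hX : IsEllitopicData Sk T)
    (B : Matrix (Fin ν) (Fin N) ℝ) :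
    IsGreatest (traceValues B Sk T) (Mstar B Sk T ^ 2) := by
  obtain ⟨t, ht⟩ := hX.nonempty
  have h0 : (0 : ℝ) ∈ traceValues B Sk T :=
    ⟨0, ⟨PosSemidef.zero, t, ht, fun k => by simpa using hX.nonneg t ht k⟩, by simp⟩
  have hc : IsCompact (traceValues B Sk T) :=
    hX.isCompact_traceSet.image 
      (f := fun Q : Matrix (Fin N) (Fin N) ℝ => (B * Q * Bᵀ).trace) (by fun_prop)
  have hg := hc.isGreatest_sSup ⟨0, h0⟩
  rwa [Mstar, Real.sq_sqrt (hg.2 h0)]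

end Program

/-! ### Minimax duality and the least favorable covariance. -/

theorem exists_forall_nonneg_of_forall_exists {E F : Type*}
    [TopologicalSpace E] [AddCommGroup E] [Module ℝ E] [IsTopologicalAddGroup E]
    [ContinuousSMul ℝ E] [TopologicalSpace F] [AddCommGroup F] [Module ℝ F]
    [IsTopologicalAddGroup F] [ContinuousSMul ℝ F] {X : Set E} {Y : Set F} {g : E → F → ℝ}
    (hne : X.Nonempty) (hXc : IsCompact X) (hX : Convex ℝ X) (hY : Convex ℝ Y)
    (hgx : ∀ y ∈ Y, Continuous fun x => g x y) (hgx' : ∀ y ∈ Y, ConcaveOn ℝ X fun x => g x y)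
    (hgy : ∀ x ∈ X, Continuous fun y => g x y) (hgy' : ∀ x ∈ X, ConvexOn ℝ Y fun y => g x y)
    (h : ∀ y ∈ Y, ∃ x ∈ X, 0 ≤ g x y) : ∃ x ∈ X, ∀ y ∈ Y, 0 ≤ g x y := by
  by_contra! hcon
  -- `Y` is not assumed compact, but compactness of `X` leaves finitely many `y`, one of which makes
  -- `g` negative at each `x`. Sion's argument for finite families merges them into a single `y₀`
  -- negative on all of `X`, against `h`.
  obtain ⟨s, hs, hsf, hcov⟩ := hXc.elim_finite_subcover_image (b := Y)
    (c := fun y => {x | g x y < 0}) (fun y hy => isOpen_lt (hgx y hy) continuous_const)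
    (fun x hx => by
      obtain ⟨y, hy, hxy⟩ := hcon x hx
      exact Set.mem_iUnion₂.2 ⟨y, hy, hxy⟩)
  obtain ⟨y₀, hy₀, h₀⟩ := Sion.exists_lt_iInf_of_lt_iInf_of_finite (f := fun x y => -g x y)
    hne hXc (fun y hy => ((hgx y hy).neg.lowerSemicontinuous).lowerSemicontinuousOn _)
    (fun y hy => (hgx' y hy).neg.quasiconvexOn) hY
    (fun x hx => ((hgy x hx).neg.upperSemicontinuous).upperSemicontinuousOn _)
    (fun x hx => (hgy' x hx).neg.quasiconcaveOn) hX hsf hs (t := 0)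
    (fun x hx => by
      obtain ⟨y, hy, hxy⟩ := Set.mem_iUnion₂.1 (hcov hx)
      exact ⟨y, hy, by simpa using hxy⟩)
  obtain ⟨x, hx, hxy⟩ := h y₀ hy₀
  have := h₀ x hx
  linarith

section Duality

variable {N m ν K : ℕ} {A : Matrix (Fin m) (Fin N) ℝ} {B : Matrix (Fin ν) (Fin N) ℝ}
  {S : Matrix (Fin N) (Fin N) ℝ} {σ : ℝ} {Sk : Fin K → Matrix (Fin N) (Fin N) ℝ}
  {T : Set (Fin K → ℝ)}

/-- The Bayesian risk of the linear estimate `Hᵀ ω` under the prior `𝒩(0, Q)`. -/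
noncomputable def linearCost (A : Matrix (Fin m) (Fin N) ℝ) (B : Matrix (Fin ν) (Fin N) ℝ) (σ : ℝ)
    (Q : Matrix (Fin N) (Fin N) ℝ) (H : Matrix (Fin m) (Fin ν) ℝ) : ℝ :=
  ((B - Hᵀ * A) * Q * (B - Hᵀ * A)ᵀ).trace + σ ^ 2 * (Hᵀ * H).trace

theorem linearCost_convex {Q : Matrix (Fin N) (Fin N) ℝ} (hQ : Q.PosSemidef)
    (H₁ H₂ : Matrix (Fin m) (Fin ν) ℝ) {a b : ℝ} (ha : 0 ≤ a) (hb : 0 ≤ b) (hab : a + b = 1) :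
    linearCost A B σ Q (a • H₁ + b • H₂) ≤
      a * linearCost A B σ Q H₁ + b * linearCost A B σ Q H₂ := by
  have h1 : B - (a • H₁ + b • H₂)ᵀ * A = a • (B - H₁ᵀ * A) + b • (B - H₂ᵀ * A) := by
    simp only [transpose_add, transpose_smul, Matrix.add_mul, smul_mul, smul_sub]
    have : B = a • B + b • B := by rw [← add_smul, hab, one_smul]
    nth_rewrite 1 [this]
    abel
  have h2 := trace_quadratic_convex hQ (B - H₁ᵀ * A) (B - H₂ᵀ * A) ha hb hab
  have h3 := trace_quadratic_convex (PosSemidef.one (n := Fin m) (R := ℝ)) H₁ᵀ H₂ᵀ ha hb hab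
  simp only [Matrix.mul_one, ← transpose_smul, ← transpose_add, transpose_transpose] at h3
  have h4 := mul_le_mul_of_nonneg_left h3 (sq_nonneg σ)
  unfold linearCost
  rw [h1]
  linarith

theorem linearCost_eq (Q : Matrix (Fin N) (Fin N) ℝ) (H : Matrix (Fin m) (Fin ν) ℝ) :
    linearCost A B σ Q H =
      (Q * ((B - Hᵀ * A)ᵀ * (B - Hᵀ * A))).trace + σ ^ 2 * (Hᵀ * H).trace := by
  rw [linearCost, trace_mul_cycle, trace_mul_comm]

/-- Scaling the prior scales the bias term exactly and leaves the nonnegative noise term unchanged.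
-/
theorem linearCost_smul_ge (Q : Matrix (Fin N) (Fin N) ℝ)
    (H : Matrix (Fin m) (Fin ν) ℝ) {δ : ℝ} (hδ : δ ≤ 1) :
    δ * linearCost A B σ Q H ≤ linearCost A B σ (δ • Q) H := by
  have h := mul_nonneg (sq_nonneg σ) (trace_transpose_mul_self_nonneg H)
  simp only [linearCost, Matrix.mul_smul, smul_mul, trace_smul, smul_eq_mul, mul_add]
  nlinarith

/-- The pointwise hypothesis of the minimax theorem. If the Lagrangian were at most `-ε` on the
compact set of pairs, then `H` with enlarged multipliers would be feasible at a value below `τ`. The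
redundant bound `Tr(Q ∑ S_k) ≤ r` only serves compactness; its multiplier is absorbed into `λ`. -/
theorem exists_saddle_nonneg (hX : IsEllitopicData Sk T) (hS : S.PosSemidef) {τ : ℝ}
    (hopt : ∀ (τ' : ℝ) (H' : Matrix (Fin m) (Fin ν) ℝ) (lam' : Fin K → ℝ),
      DesignFeasible A B S σ Sk T τ' H' lam' → τ ≤ τ')
    {r : ℝ} (hr : 0 < r) (hsum : ∀ t ∈ T, ∑ k, t k ≤ r)
    (H : Matrix (Fin m) (Fin ν) ℝ) (lam : Fin K → ℝ) (hlam : ∀ k, 0 ≤ lam k) :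
    ∃ p ∈ {Q : Matrix (Fin N) (Fin N) ℝ | Q.PosSemidef ∧ (Q * ∑ k, Sk k).trace ≤ r} ×ˢ T,
      0 ≤ linearCost A B σ p.1 H - τ * (1 + (p.1 * S).trace) +
        ∑ k, lam k * (p.2 k - (p.1 * Sk k).trace) := by
  by_contra! hcon
  obtain ⟨t₀, ht₀⟩ := hX.nonempty
  have hcomp := (isCompact_posSemidef_trace_le hX.posDef_sum r).prod hX.isCompact
  have hz : ((0 : Matrix (Fin N) (Fin N) ℝ) * ∑ k, Sk k).trace ≤ r := by simpa using hr.le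
  obtain ⟨p₁, hp₁, hmax⟩ := hcomp.exists_isMaxOn ⟨((0 : Matrix (Fin N) (Fin N) ℝ), t₀),
      ⟨PosSemidef.zero, hz⟩, ht₀⟩
    (f := fun p => linearCost A B σ p.1 H - τ * (1 + (p.1 * S).trace) +
        ∑ k, lam k * (p.2 k - (p.1 * Sk k).trace)) (by unfold linearCost; fun_prop)
  obtain ⟨ε, hε, hεle⟩ : ∃ ε : ℝ, 0 < ε ∧ ∀ (Q : Matrix (Fin N) (Fin N) ℝ) (t : Fin K → ℝ),
      Q.PosSemidef → (Q * ∑ k, Sk k).trace ≤ r → t ∈ T →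
      linearCost A B σ Q H - τ * (1 + (Q * S).trace) +
        ∑ k, lam k * (t k - (Q * Sk k).trace) ≤ -ε := by
    refine ⟨_, neg_pos.2 (hcon p₁ hp₁), fun Q t hQ hQr ht => ?_⟩
    rw [neg_neg]
    exact hmax (a := (Q, t)) ⟨⟨hQ, hQr⟩, ht⟩
  clear hmax hcon hp₁ p₁
  obtain ⟨t₁, ht₁, htmax⟩ := hX.isCompact.exists_isMaxOn hX.nonempty
    (f := fun t => lam ⬝ᵥ t) (by fun_prop)
  set h₂ := σ ^ 2 * (Hᵀ * H).trace with hh₂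
  -- The multiplier of `Tr(Q ∑ S_k) ≤ r`; testing with `Q = 0` shows that it is nonnegative.
  set μ := (τ - ε - h₂ - lam ⬝ᵥ t₁) / r with hμ
  have hμr : μ * r = τ - ε - h₂ - lam ⬝ᵥ t₁ := div_mul_cancel₀ _ hr.ne'
  have hμ0 : 0 ≤ μ := by
    have := hεle 0 t₁ PosSemidef.zero hz ht₁
    simp only [linearCost, Matrix.mul_zero, Matrix.zero_mul, trace_zero, sub_zero, add_zero,
      mul_one, zero_add, ← hh₂] at this
    refine div_nonneg ?_ hr.le
    rw [dotProduct]
    linarith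
  have hquad : ∀ u : Fin N → ℝ, ((B - Hᵀ * A) *ᵥ u) ⬝ᵥ ((B - Hᵀ * A) *ᵥ u) ≤
      ∑ k, (lam k + μ) * (u ⬝ᵥ (Sk k *ᵥ u)) + τ * (u ⬝ᵥ (S *ᵥ u)) := by
    intro u
    rcases eq_or_ne u 0 with rfl | hu
    · simp
    have hs : 0 < u ⬝ᵥ ((∑ k, Sk k) *ᵥ u) := by
      simpa using hX.posDef_sum.dotProduct_mulVec_pos hu
    set s := u ⬝ᵥ ((∑ k, Sk k) *ᵥ u) with hs_def
    have htr : ∀ M : Matrix (Fin N) (Fin N) ℝ,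
        (((r / s) • vecMulVec u u) * M).trace = r / s * (u ⬝ᵥ (M *ᵥ u)) := by
      intro M
      rw [smul_mul, trace_smul, trace_vecMulVec_mul, smul_eq_mul]
    -- A rank-one `Q` scaled to make the trace bound tight turns the inequality for `Q` into one for
    -- the quadratic form at `u`.
    have h := hεle ((r / s) • vecMulVec u u) t₁ ((posSemidef_vecMulVec u).smul (by positivity))
      (by rw [htr, ← hs_def, div_mul_cancel₀ _ hs.ne']) ht₁
    rw [linearCost_eq, htr, htr, ← dotProduct_mulVec_self] at h
    simp only [htr, mul_sub, Finset.sum_sub_distrib] at h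
    rw [← hh₂, ← dotProduct] at h
    have hpull : ∑ k, lam k * (r / s * (u ⬝ᵥ (Sk k *ᵥ u))) =
        r / s * ∑ k, lam k * (u ⬝ᵥ (Sk k *ᵥ u)) := by
      rw [Finset.mul_sum]
      exact Finset.sum_congr rfl fun k _ => by ring
    rw [hpull] at h
    have h3 : r / s * (((B - Hᵀ * A) *ᵥ u) ⬝ᵥ ((B - Hᵀ * A) *ᵥ u) -
        ∑ k, lam k * (u ⬝ᵥ (Sk k *ᵥ u)) - τ * (u ⬝ᵥ (S *ᵥ u))) ≤ r / s * (μ * s) := by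
      have : r / s * (μ * s) = μ * r := by field_simp
      rw [this, hμr]
      linarith
    have h4 := le_of_mul_le_mul_left h3 (by positivity)
    simp only [add_mul, Finset.sum_add_distrib, ← Finset.mul_sum]
    rw [← quadForm_univ_sum, ← hs_def]
    linarith
  obtain ⟨c, hc, hcS⟩ := hX.posDef_sum.exists_quadForm_le_mul S
  -- Lowering `τ` by `ε'` weakens the term in `S`, and adding `ε' c` to every multiplier repairs
  -- this because `S ⪯ c ∑ S_k`. The repair raises the support function by at most `ε' c r`, so the
  -- slack `ε` pays for both.
  set ε' := ε / (1 + c * r) with hε'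
  have hcr : 0 < 1 + c * r := by positivity
  have hε'pos : 0 < ε' := by positivity
  have hε'mul : ε' * (1 + c * r) = ε := div_mul_cancel₀ _ hcr.ne'
  have := hopt (τ - ε') H (fun k => lam k + μ + ε' * c) ((designFeasible_iff hX hS).2
    ⟨fun y => ?_, fun t ht => ?_, fun k => by have := hlam k; positivity⟩)
  · linarith
  · refine (hquad y).trans ?_
    simp only [add_mul _ (ε' * c), Finset.sum_add_distrib, ← Finset.mul_sum]
    rw [← quadForm_univ_sum]
    have := mul_le_mul_of_nonneg_left (hcS y) hε'pos.le
    linarith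
  · have h5 : (fun k => lam k + μ + ε' * c) ⬝ᵥ t = lam ⬝ᵥ t + (μ + ε' * c) * ∑ k, t k := by
      simp only [dotProduct, add_mul, Finset.sum_add_distrib, Finset.mul_sum]
      ring
    have h6 : lam ⬝ᵥ t ≤ lam ⬝ᵥ t₁ := htmax ht
    have h7 := mul_le_mul_of_nonneg_left (hsum t ht) (show 0 ≤ μ + ε' * c by positivity)
    rw [h5, ← hh₂]
    linarith

/-- Exchanging the quantifiers in `exists_saddle_nonneg` gives one pair `(Q, t)` that works for all
`(H, λ)`. Letting `λ` be large forces the trace constraints, and `λ = 0` gives the bound on the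
cost. -/
theorem exists_leastFavorable (hX : IsEllitopicData Sk T) (hS : S.PosSemidef) {τ : ℝ}
    (hopt : ∀ (τ' : ℝ) (H' : Matrix (Fin m) (Fin ν) ℝ) (lam' : Fin K → ℝ),
      DesignFeasible A B S σ Sk T τ' H' lam' → τ ≤ τ') :
    ∃ Q : Matrix (Fin N) (Fin N) ℝ, Q.PosSemidef ∧ (∃ t ∈ T, ∀ k, (Q * Sk k).trace ≤ t k) ∧
      ∀ H : Matrix (Fin m) (Fin ν) ℝ, τ * (1 + (Q * S).trace) ≤ linearCost A B σ Q H := by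
  obtain ⟨r, hr, hsum⟩ := hX.exists_sum_le
  obtain ⟨t₀, ht₀⟩ := hX.nonempty
  have hz : ((0 : Matrix (Fin N) (Fin N) ℝ) * ∑ k, Sk k).trace ≤ r := by simpa using hr.le
  have hcX : Convex ℝ ({Q : Matrix (Fin N) (Fin N) ℝ |
      Q.PosSemidef ∧ (Q * ∑ k, Sk k).trace ≤ r} ×ˢ T) := by
    refine (convex_posSemidef.inter fun x hx y hy a b ha hb hab => ?_).prod hX.convex
    have hx' : (x * ∑ k, Sk k).trace ≤ r := hx
    have hy' : (y * ∑ k, Sk k).trace ≤ r := hy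
    show ((a • x + b • y) * _).trace ≤ r
    simp only [Matrix.add_mul, smul_mul, trace_add, trace_smul, smul_eq_mul]
    nlinarith
  have hcY : Convex ℝ {q : Matrix (Fin m) (Fin ν) ℝ × (Fin K → ℝ) | ∀ k, 0 ≤ q.2 k} := by
    intro x hx y hy a b ha hb hab k
    have h1 := hx k
    have h2 := hy k
    show 0 ≤ a * x.2 k + b * y.2 k
    positivity
  let g : Matrix (Fin N) (Fin N) ℝ × (Fin K → ℝ) → Matrix (Fin m) (Fin ν) ℝ × (Fin K → ℝ) → ℝ :=
    fun p q => linearCost A B σ p.1 q.1 - τ * (1 + (p.1 * S).trace) +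
        ∑ k, q.2 k * (p.2 k - (p.1 * Sk k).trace)
  have hgx : ∀ q ∈ {q : Matrix (Fin m) (Fin ν) ℝ × (Fin K → ℝ) | ∀ k, 0 ≤ q.2 k},
      ConcaveOn ℝ ({Q : Matrix (Fin N) (Fin N) ℝ |
      Q.PosSemidef ∧ (Q * ∑ k, Sk k).trace ≤ r} ×ˢ T) fun p => g p q := by
    refine fun q _ => ⟨hcX, fun x _ y _ a b _ _ hab => ?_⟩
    obtain rfl : b = 1 - a := by linarith
    refine le_of_eq ?_
    simp only [g, linearCost, Prod.fst_add, Prod.snd_add, Prod.smul_fst, Prod.smul_snd, Matrix.add_mul,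
      Matrix.mul_add, smul_mul, Matrix.mul_smul, trace_add, trace_smul, smul_eq_mul, Pi.add_apply,
      Pi.smul_apply]
    have : ∀ k, q.2 k * (a * x.2 k + (1 - a) * y.2 k -
        (a * (x.1 * Sk k).trace + (1 - a) * (y.1 * Sk k).trace)) =
        a * (q.2 k * (x.2 k - (x.1 * Sk k).trace)) +
        (1 - a) * (q.2 k * (y.2 k - (y.1 * Sk k).trace)) := fun k => by ring
    simp only [this, Finset.sum_add_distrib, ← Finset.mul_sum]
    ring
  have hgy : ∀ p ∈ {Q : Matrix (Fin N) (Fin N) ℝ |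
      Q.PosSemidef ∧ (Q * ∑ k, Sk k).trace ≤ r} ×ˢ T,
      ConvexOn ℝ {q : Matrix (Fin m) (Fin ν) ℝ × (Fin K → ℝ) | ∀ k, 0 ≤ q.2 k} (g p) := by
    refine fun p hp => ⟨hcY, fun x _ y _ a b ha hb hab => ?_⟩
    have h1 := linearCost_convex (A := A) (B := B) (σ := σ) hp.1.1 x.1 y.1 ha hb hab
    have : ∀ k, (a • x + b • y).2 k * (p.2 k - (p.1 * Sk k).trace) =
        a * (x.2 k * (p.2 k - (p.1 * Sk k).trace)) +
        b * (y.2 k * (p.2 k - (p.1 * Sk k).trace)) := fun k => by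
      simp only [Prod.snd_add, Prod.smul_snd, Pi.add_apply, Pi.smul_apply, smul_eq_mul]
      ring
    simp only [g, this, Finset.sum_add_distrib, ← Finset.mul_sum]
    simp only [Prod.fst_add, Prod.smul_fst, smul_eq_mul]
    obtain rfl : b = 1 - a := by linarith
    linarith
  have hne : ({Q : Matrix (Fin N) (Fin N) ℝ |
      Q.PosSemidef ∧ (Q * ∑ k, Sk k).trace ≤ r} ×ˢ T).Nonempty :=
    ⟨(0, t₀), ⟨PosSemidef.zero, hz⟩, ht₀⟩
  obtain ⟨⟨Q, t⟩, ⟨⟨hQ, -⟩, ht⟩, h⟩ := exists_forall_nonneg_of_forall_exists (g := g)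
    hne ((isCompact_posSemidef_trace_le hX.posDef_sum r).prod hX.isCompact) hcX hcY
    (fun q _ => by unfold g linearCost; fun_prop) hgx
    (fun p _ => by unfold g linearCost; fun_prop) hgy
    (fun q hq => exists_saddle_nonneg hX hS hopt hr hsum q.1 q.2 hq)
  simp only [g] at h
  have hfeas : ∀ k, (Q * Sk k).trace ≤ t k := by
    intro k
    by_contra! hlt
    set c := linearCost A B σ Q (0 : Matrix (Fin m) (Fin ν) ℝ) - τ * (1 + (Q * S).trace)
    have hd : 0 < (Q * Sk k).trace - t k := by linarith
    -- This weight makes the penalty for a violated constraint equal `-(|c| + 1)`, below `-c`.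
    have h1 := h (0, Pi.single k ((|c| + 1) / ((Q * Sk k).trace - t k))) (fun l => by
      by_cases hl : l = k
      · subst hl
        simpa using by positivity
      · simp [hl])
    simp only [Pi.single_apply, ite_mul, zero_mul, Finset.sum_ite_eq', Finset.mem_univ,
      if_true] at h1
    have h2 : (|c| + 1) / ((Q * Sk k).trace - t k) * (t k - (Q * Sk k).trace) = -(|c| + 1) := by
      field_simp
      ring
    linarith [le_abs_self c]
  refine ⟨Q, hQ, ⟨t, ht, hfeas⟩, fun H => ?_⟩
  have := h (H, 0) (fun _ => le_rfl)
  simp only [Pi.zero_apply, zero_mul, Finset.sum_const_zero, add_zero] at this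
  linarith

end Duality

/-! ### Gaussian moments and the tail estimate. -/

section Gaussian

instance isGaussian_stdNormal (m : ℕ) : IsGaussian (stdNormal m) := by
  rw [← isGaussian_map_equiv_iff (EuclideanSpace.equiv (Fin m) ℝ).symm]
  have h := map_pi_eq_stdGaussian (ι := Fin m)
  change IsGaussian (Measure.map (WithLp.toLp 2) (Measure.pi fun _ => gaussianReal 0 1))
  rw [h]
  infer_instance

/-- The linear functional `x ↦ a ⬝ᵥ x`. -/
noncomputable def dotProductCLM {n : ℕ} (a : Fin n → ℝ) : (Fin n → ℝ) →L[ℝ] ℝ :=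
  LinearMap.toContinuousLinearMap
    { toFun := fun x => a ⬝ᵥ x
      map_add' := fun x y => dotProduct_add a x y
      map_smul' := fun c x => dotProduct_smul c a x }

theorem memLp_dotProduct_stdNormal {n : ℕ} (a : Fin n → ℝ) :
    MemLp (fun x => a ⬝ᵥ x) 2 (stdNormal n) :=
  IsGaussian.memLp_dual (stdNormal n) (dotProductCLM a) 2 (by simp)

theorem integral_dotProduct_stdNormal {n : ℕ} (a : Fin n → ℝ) :
    ∫ x, a ⬝ᵥ x ∂(stdNormal n) = 0 := by
  simp only [dotProduct]
  rw [integral_finsetSum]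
  · refine Finset.sum_eq_zero fun i _ => ?_
    have h : ∫ x : Fin n → ℝ, x i ∂(stdNormal n) = 0 :=
      (integral_comp_eval (μ := fun _ : Fin n => gaussianReal 0 1) (i := i)
        (f := fun x : ℝ => x) (by fun_prop)).trans integral_id_gaussianReal
    rw [integral_const_mul, h, mul_zero]
  · intro i _
    have h := (memLp_dotProduct_stdNormal (Pi.single i (a i))).integrable one_le_two
    simpa using h

theorem variance_dotProduct_stdNormal {n : ℕ} (a : Fin n → ℝ) :
    Var[fun x => a ⬝ᵥ x; stdNormal n] = a ⬝ᵥ a := by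
  have h := variance_sum_pi (μ := fun _ : Fin n => gaussianReal 0 1)
    (X := fun i x => a i * x) (fun i => (memLp_id_gaussianReal 2).const_mul (a i))
  have h2 : (∑ i, fun ω : Fin n → ℝ => a i * ω i) = fun x => a ⬝ᵥ x := by
    ext x
    simp [dotProduct]
  rw [h2] at h
  rw [stdNormal, h, dotProduct]
  refine Finset.sum_congr rfl fun i _ => ?_
  rw [variance_const_mul, variance_fun_id_gaussianReal]
  simp [sq]

theorem map_dotProduct_stdNormal {n : ℕ} (a : Fin n → ℝ) :
    (stdNormal n).map (fun x => a ⬝ᵥ x) = gaussianReal 0 (a ⬝ᵥ a).toNNReal := by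
  have h := IsGaussian.map_eq_gaussianReal (μ := stdNormal n) (dotProductCLM a)
  have h1 := integral_dotProduct_stdNormal a
  have h2 := variance_dotProduct_stdNormal a
  change Measure.map (fun x => a ⬝ᵥ x) _ = gaussianReal (∫ x, a ⬝ᵥ x ∂(stdNormal n))
    (Var[fun x => a ⬝ᵥ x; stdNormal n]).toNNReal at h
  rw [h, h1, h2]

theorem integral_sq_dotProduct_stdNormal {n : ℕ} (a : Fin n → ℝ) :
    ∫ x, (a ⬝ᵥ x) ^ 2 ∂(stdNormal n) = a ⬝ᵥ a := by
  rw [← variance_dotProduct_stdNormal, variance_of_integral_eq_zero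
    (memLp_dotProduct_stdNormal a).aemeasurable (integral_dotProduct_stdNormal a)]

theorem integral_mul_dotProduct_stdNormal {n : ℕ} (a b : Fin n → ℝ) :
    ∫ x, (a ⬝ᵥ x) * (b ⬝ᵥ x) ∂(stdNormal n) = a ⬝ᵥ b := by
  have hi : ∀ c : Fin n → ℝ, Integrable (fun x => (c ⬝ᵥ x) ^ 2) (stdNormal n) :=
    fun c => (memLp_dotProduct_stdNormal c).integrable_sq
  have h : ∀ x, (a ⬝ᵥ x) * (b ⬝ᵥ x) =
      (1 / 4) * (((a + b) ⬝ᵥ x) ^ 2 - ((a - b) ⬝ᵥ x) ^ 2) := by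
    intro x
    rw [add_dotProduct, sub_dotProduct]
    ring
  simp_rw [h]
  rw [integral_const_mul, integral_sub (hi _) (hi _), integral_sq_dotProduct_stdNormal,
    integral_sq_dotProduct_stdNormal]
  simp only [add_dotProduct, sub_dotProduct, dotProduct_add, dotProduct_sub, dotProduct_comm b a]
  ring

/-- As `-x²/2 + x²/3 = -x²/6`, tilting the standard normal by `exp(x²/3)` gives variance `3`, up to
the factor `√3`. This yields the moments `E exp(g²/3) = √3` and `E g² exp(g²/3) = 3√3`. -/
theorem gaussianPDFReal_mul_exp (x : ℝ) :
    gaussianPDFReal 0 1 x * Real.exp (x ^ 2 / 3) = Real.sqrt 3 * gaussianPDFReal 0 3 x := by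
  simp only [gaussianPDFReal, sub_zero, NNReal.coe_one, mul_one, NNReal.coe_ofNat]
  rw [mul_assoc, ← Real.exp_add, Real.sqrt_mul (by positivity) 3, mul_inv]
  have h3 : Real.sqrt 3 ≠ 0 := by positivity
  have : -x ^ 2 / 2 + x ^ 2 / 3 = -x ^ 2 / (2 * 3) := by ring
  rw [this]
  field_simp

theorem integrable_gaussianReal_mul_exp {f : ℝ → ℝ} (hf : Integrable f (gaussianReal 0 3)) :
    Integrable (fun x => f x * Real.exp (x ^ 2 / 3)) (gaussianReal 0 1) := by
  rw [gaussianReal_of_var_ne_zero _ (by norm_num), integrable_withDensity_iff_integrable_smul'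
    (measurable_gaussianPDF _ _) (by simp [gaussianPDF])] at hf ⊢
  simp only [toReal_gaussianPDF, smul_eq_mul] at hf ⊢
  refine (hf.const_mul (Real.sqrt 3)).congr (Filter.Eventually.of_forall fun x => ?_)
  linear_combination -f x * gaussianPDFReal_mul_exp x

theorem integral_gaussianReal_mul_exp (f : ℝ → ℝ) :
    ∫ x, f x * Real.exp (x ^ 2 / 3) ∂(gaussianReal 0 1) =
      Real.sqrt 3 * ∫ x, f x ∂(gaussianReal 0 3) := by
  rw [integral_gaussianReal_eq_integral_smul (by norm_num),
    integral_gaussianReal_eq_integral_smul (by norm_num), ← integral_const_mul]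
  refine integral_congr_ae (Filter.Eventually.of_forall fun x => ?_)
  simp only [smul_eq_mul]
  linear_combination f x * gaussianPDFReal_mul_exp x

theorem integral_sq_gaussianReal (v : NNReal) : ∫ x, x ^ 2 ∂(gaussianReal 0 v) = v := by
  rw [← variance_fun_id_gaussianReal (μ := 0) (v := v),
    variance_of_integral_eq_zero (by fun_prop) integral_id_gaussianReal]

/-- The normalized linear functional `x ↦ (a ⬝ᵥ x) / ‖a‖₂`. -/
noncomputable def unitFunctional {n : ℕ} (a x : Fin n → ℝ) : ℝ := (a ⬝ᵥ x) / Real.sqrt (a ⬝ᵥ a)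

theorem dotProduct_self_nonneg_of_real {n : ℕ} (a : Fin n → ℝ) : 0 ≤ a ⬝ᵥ a :=
  Finset.sum_nonneg fun _ _ => mul_self_nonneg _

/-- This also covers `a = 0`, where both sides vanish, so zero rows need no separate treatment in
the sums below. -/
theorem mul_sq_unitFunctional {n : ℕ} (a x : Fin n → ℝ) :
    (a ⬝ᵥ a) * unitFunctional a x ^ 2 = (a ⬝ᵥ x) ^ 2 := by
  rcases eq_or_ne a 0 with rfl | ha
  · simp
  have hpos : 0 < a ⬝ᵥ a := by simpa using dotProduct_star_self_pos_iff.2 ha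
  rw [unitFunctional, div_pow, Real.sq_sqrt hpos.le]
  field_simp

theorem measurable_unitFunctional {n : ℕ} (a : Fin n → ℝ) : Measurable (unitFunctional a) := by
  unfold unitFunctional dotProduct
  fun_prop

theorem map_unitFunctional {n : ℕ} {a : Fin n → ℝ} (ha : a ≠ 0) :
    (stdNormal n).map (unitFunctional a) = gaussianReal 0 1 := by
  have hpos : 0 < a ⬝ᵥ a := by simpa using dotProduct_star_self_pos_iff.2 ha
  have h : unitFunctional a = fun x => ((Real.sqrt (a ⬝ᵥ a))⁻¹ • a) ⬝ᵥ x := by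
    ext x
    rw [unitFunctional, smul_dotProduct, smul_eq_mul, div_eq_inv_mul]
  rw [h, map_dotProduct_stdNormal]
  congr
  rw [smul_dotProduct, dotProduct_smul, smul_eq_mul, smul_eq_mul, ← mul_assoc, ← mul_inv,
    Real.mul_self_sqrt hpos.le, inv_mul_cancel₀ hpos.ne', Real.toNNReal_one]

theorem integrable_exp_unitFunctional {n : ℕ} (a : Fin n → ℝ) :
    Integrable (fun x => Real.exp (unitFunctional a x ^ 2 / 3)) (stdNormal n) := by
  rcases eq_or_ne a 0 with rfl | ha
  · simp [unitFunctional]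
  have h := integrable_gaussianReal_mul_exp (f := fun _ => 1) (integrable_const _)
  rw [← map_unitFunctional ha] at h
  simpa [Function.comp_def] using h.comp_measurable (measurable_unitFunctional a)

theorem integrable_sq_mul_exp_unitFunctional {n : ℕ} (a : Fin n → ℝ) :
    Integrable (fun x => unitFunctional a x ^ 2 * Real.exp (unitFunctional a x ^ 2 / 3))
      (stdNormal n) := by
  rcases eq_or_ne a 0 with rfl | ha
  · simp [unitFunctional]
  have h := integrable_gaussianReal_mul_exp (f := fun x => x ^ 2)
    (memLp_id_gaussianReal 2).integrable_sq
  rw [← map_unitFunctional ha] at h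
  exact h.comp_measurable (measurable_unitFunctional a)

theorem integral_exp_unitFunctional_le {n : ℕ} (a : Fin n → ℝ) :
    ∫ x, Real.exp (unitFunctional a x ^ 2 / 3) ∂(stdNormal n) ≤ Real.sqrt 3 := by
  rcases eq_or_ne a 0 with rfl | ha
  · simp [unitFunctional]
  have h := integral_gaussianReal_mul_exp (fun _ => 1)
  rw [← map_unitFunctional ha, integral_map (measurable_unitFunctional a).aemeasurable
    (by fun_prop)] at h
  simp only [one_mul, integral_const, smul_eq_mul, mul_one, probReal_univ] at h
  exact h.le

theorem integral_sq_mul_exp_unitFunctional_le {n : ℕ} (a : Fin n → ℝ) :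
    ∫ x, unitFunctional a x ^ 2 * Real.exp (unitFunctional a x ^ 2 / 3) ∂(stdNormal n) ≤
      3 * Real.sqrt 3 := by
  rcases eq_or_ne a 0 with rfl | ha
  · simp [unitFunctional]
  have h := integral_gaussianReal_mul_exp (fun x => x ^ 2)
  rw [← map_unitFunctional ha, integral_map (measurable_unitFunctional a).aemeasurable
    (by fun_prop), integral_sq_gaussianReal] at h
  rw [h]
  simp [mul_comm]

/-- Decouples two correlated Gaussians: each term on the right involves one variable only, so its
expectation is explicit. -/
theorem mul_exp_le_add {a b : ℝ} (ha : 0 ≤ a) (hb : 0 ≤ b) :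
    a * Real.exp (b / 3) ≤ a * Real.exp (a / 3) + b * Real.exp (b / 3) := by
  rcases le_total a b with h | h
  · have h1 := mul_le_mul_of_nonneg_right h (Real.exp_nonneg (b / 3))
    have h2 := mul_nonneg ha (Real.exp_nonneg (a / 3))
    linarith
  · have h1 : Real.exp (b / 3) ≤ Real.exp (a / 3) := Real.exp_le_exp.2 (by linarith)
    have h2 := mul_le_mul_of_nonneg_left h1 ha
    have h3 := mul_nonneg hb (Real.exp_nonneg (b / 3))
    linarith

theorem trace_mul_transpose_eq_sum {p n : ℕ} (D : Matrix (Fin p) (Fin n) ℝ) :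
    (D * Dᵀ).trace = ∑ i, D i ⬝ᵥ D i := by
  simp [trace, mul_apply, dotProduct]

theorem mulVec_dotProduct_self_eq_sum {p n : ℕ} (D : Matrix (Fin p) (Fin n) ℝ) (x : Fin n → ℝ) :
    (D *ᵥ x) ⬝ᵥ (D *ᵥ x) = ∑ i, (D i ⬝ᵥ D i) * unitFunctional (D i) x ^ 2 := by
  simp only [mul_sq_unitFunctional]
  simp [dotProduct, mulVec, sq]

/-- A pointwise Chernoff bound. `‖Dx‖² / Tr(D Dᵀ)` is a convex combination of the squared normalized
row functionals, so Jensen's inequality for `exp` applies; no diagonalization or independence of the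
rows is needed. -/
theorem exp_quadForm_le {p n : ℕ} (D : Matrix (Fin p) (Fin n) ℝ) {t δ : ℝ} (hδ : 0 < δ)
    (ht : (D * Dᵀ).trace ≤ t) (x : Fin n → ℝ) (hx : t < δ * ((D *ᵥ x) ⬝ᵥ (D *ᵥ x))) :
    1 ≤ Real.exp (-(1 / (3 * δ))) * ∑ i, (D i ⬝ᵥ D i) / (D * Dᵀ).trace *
      Real.exp (unitFunctional (D i) x ^ 2 / 3) := by
  set s := (D * Dᵀ).trace with hs
  have hsum : s = ∑ i, D i ⬝ᵥ D i := trace_mul_transpose_eq_sum D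
  have hs0 : 0 ≤ s := (posSemidef_mul_transpose_self D).trace_nonneg
  have hspos : 0 < s := by
    refine hs0.lt_of_ne' fun h0 => ?_
    have h1 : ∀ i, D i ⬝ᵥ D i = 0 := by
      have := (Finset.sum_eq_zero_iff_of_nonneg fun i _ => dotProduct_self_nonneg_of_real (D i)).1
        (hsum.symm.trans h0)
      exact fun i => this i (Finset.mem_univ i)
    rw [mulVec_dotProduct_self_eq_sum] at hx
    simp only [h1, zero_mul, Finset.sum_const_zero, mul_zero] at hx
    linarith
  have hconv := convexOn_exp.map_sum_le (t := Finset.univ) (w := fun i => (D i ⬝ᵥ D i) / s)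
    (p := fun i => unitFunctional (D i) x ^ 2 / 3)
    (fun i _ => div_nonneg (dotProduct_self_nonneg_of_real _) hs0)
    (by rw [← Finset.sum_div, ← hsum, div_self hspos.ne']) (fun i _ => Set.mem_univ _)
  simp only [smul_eq_mul] at hconv
  have h2 : ∑ i, (D i ⬝ᵥ D i) / s * (unitFunctional (D i) x ^ 2 / 3) =
      ((D *ᵥ x) ⬝ᵥ (D *ᵥ x)) / (3 * s) := by
    rw [mulVec_dotProduct_self_eq_sum, Finset.sum_div]
    refine Finset.sum_congr rfl fun i _ => ?_
    field_simp
  rw [h2] at hconv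
  have h3 : 1 / (3 * δ) ≤ ((D *ᵥ x) ⬝ᵥ (D *ᵥ x)) / (3 * s) := by
    rw [div_le_div_iff₀ (by positivity) (by positivity)]
    linarith
  calc (1 : ℝ) = Real.exp (-(1 / (3 * δ))) * Real.exp (1 / (3 * δ)) := by
        rw [← Real.exp_add]
        simp
    _ ≤ _ := mul_le_mul_of_nonneg_left ((Real.exp_le_exp.2 h3).trans hconv) (Real.exp_nonneg _)

/-- Multiplying `a + c ‖Fx‖²` by the bound of `exp_quadForm_le` and decoupling with `mul_exp_le_add`
gives `V`. Each row of `F` contributes two moments of at most `3√3`, hence the factor `6`. -/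
theorem exists_tail_majorant {p q n : ℕ} (D : Matrix (Fin p) (Fin n) ℝ)
    (F : Matrix (Fin q) (Fin n) ℝ) {t δ a c : ℝ} (hδ : 0 < δ) (ha : 0 ≤ a) (hc : 0 ≤ c)
    (ht : (D * Dᵀ).trace ≤ t) :
    ∃ V : (Fin n → ℝ) → ℝ, Integrable V (stdNormal n) ∧
      ∫ x, V x ∂(stdNormal n) ≤
        Real.exp (-(1 / (3 * δ))) * (Real.sqrt 3 * (a + 6 * c * (F * Fᵀ).trace)) ∧
      ∀ x, 0 ≤ V x ∧ (t < δ * ((D *ᵥ x) ⬝ᵥ (D *ᵥ x)) →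
        a + c * ((F *ᵥ x) ⬝ᵥ (F *ᵥ x)) ≤ V x) := by
  set s := (D * Dᵀ).trace with hs
  have hsum : s = ∑ i, D i ⬝ᵥ D i := trace_mul_transpose_eq_sum D
  have hs0 : 0 ≤ s := (posSemidef_mul_transpose_self D).trace_nonneg
  have hw0 : ∀ i, 0 ≤ (D i ⬝ᵥ D i) / s := fun i => div_nonneg (dotProduct_self_nonneg_of_real _) hs0
  have hf0 : ∀ j, 0 ≤ F j ⬝ᵥ F j := fun j => dotProduct_self_nonneg_of_real _
  -- Only an inequality: when the trace vanishes, all weights are zero by the division convention.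
  have hw1 : ∑ i, (D i ⬝ᵥ D i) / s ≤ 1 := by
    rw [← Finset.sum_div, ← hsum]
    exact div_self_le_one s
  let e : (Fin n → ℝ) → (Fin n → ℝ) → ℝ := fun v x => Real.exp (unitFunctional v x ^ 2 / 3)
  let k : (Fin n → ℝ) → (Fin n → ℝ) → ℝ := fun v x => unitFunctional v x ^ 2 * e v x
  have he : ∀ v, Integrable (e v) (stdNormal n) := integrable_exp_unitFunctional
  have hk : ∀ v, Integrable (k v) (stdNormal n) := integrable_sq_mul_exp_unitFunctional
  let V : (Fin n → ℝ) → ℝ := fun x => Real.exp (-(1 / (3 * δ))) * ∑ i, (D i ⬝ᵥ D i) / s *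
    (a * e (D i) x + c * ∑ j, (F j ⬝ᵥ F j) * (k (F j) x + k (D i) x))
  have hpair : ∀ i j, Integrable (fun x => (F j ⬝ᵥ F j) * (k (F j) x + k (D i) x))
      (stdNormal n) := fun i j => ((hk (F j)).add (hk (D i))).const_mul _
  have hinner : ∀ i, Integrable (fun x => ∑ j, (F j ⬝ᵥ F j) * (k (F j) x + k (D i) x))
      (stdNormal n) := fun i => integrable_finsetSum _ fun j _ => hpair i j
  have hterm : ∀ i, Integrable (fun x => (D i ⬝ᵥ D i) / s *
      (a * e (D i) x + c * ∑ j, (F j ⬝ᵥ F j) * (k (F j) x + k (D i) x))) (stdNormal n) :=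
    fun i => (((he (D i)).const_mul a).add ((hinner i).const_mul c)).const_mul _
  have hk0 : ∀ v x, 0 ≤ k v x := fun v x => mul_nonneg (sq_nonneg _) (Real.exp_nonneg _)
  refine ⟨V, (integrable_finsetSum _ fun i _ => hterm i).const_mul _, ?_, fun x => ⟨?_, ?_⟩⟩
  · have hint : ∀ i, ∫ x, (D i ⬝ᵥ D i) / s *
        (a * e (D i) x + c * ∑ j, (F j ⬝ᵥ F j) * (k (F j) x + k (D i) x)) ∂(stdNormal n) ≤
        (D i ⬝ᵥ D i) / s * (Real.sqrt 3 * (a + 6 * c * (F * Fᵀ).trace)) := by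
      intro i
      rw [integral_const_mul]
      refine mul_le_mul_of_nonneg_left ?_ (hw0 i)
      rw [integral_add ((he (D i)).const_mul a) ((hinner i).const_mul c), integral_const_mul,
        integral_const_mul, integral_finsetSum _ fun j _ => hpair i j]
      have h1 : ∀ j, ∫ x, (F j ⬝ᵥ F j) * (k (F j) x + k (D i) x) ∂(stdNormal n) ≤
          (F j ⬝ᵥ F j) * (6 * Real.sqrt 3) := by
        intro j
        rw [integral_const_mul, integral_add (hk _) (hk _)]
        refine mul_le_mul_of_nonneg_left ?_ (hf0 j)
        have h2 := integral_sq_mul_exp_unitFunctional_le (F j)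
        have h3 := integral_sq_mul_exp_unitFunctional_le (D i)
        simp only [k, e]
        linarith
      have h4 := Finset.sum_le_sum fun j (_ : j ∈ Finset.univ) => h1 j
      rw [← Finset.sum_mul, ← trace_mul_transpose_eq_sum] at h4
      have h5 := mul_le_mul_of_nonneg_left h4 hc
      have h6 := mul_le_mul_of_nonneg_left (integral_exp_unitFunctional_le (D i)) ha
      simp only [e] at h5 ⊢
      linarith
    simp only [V]
    rw [integral_const_mul, integral_finsetSum _ fun i _ => hterm i]
    refine mul_le_mul_of_nonneg_left ?_ (Real.exp_nonneg _)
    refine (Finset.sum_le_sum fun i _ => hint i).trans ?_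
    rw [← Finset.sum_mul]
    have := (posSemidef_mul_transpose_self F).trace_nonneg
    exact mul_le_of_le_one_left (by positivity) hw1
  · refine mul_nonneg (Real.exp_nonneg _) (Finset.sum_nonneg fun i _ => mul_nonneg (hw0 i) ?_)
    refine add_nonneg (mul_nonneg ha (Real.exp_nonneg _)) (mul_nonneg hc ?_)
    exact Finset.sum_nonneg fun j _ => mul_nonneg (hf0 j) (add_nonneg (hk0 _ _) (hk0 _ _))
  · intro hx
    have h1 := exp_quadForm_le D hδ ht x hx
    rw [← hs] at h1
    have hF0 : 0 ≤ (F *ᵥ x) ⬝ᵥ (F *ᵥ x) := dotProduct_self_nonneg_of_real _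
    have hac : 0 ≤ a + c * ((F *ᵥ x) ⬝ᵥ (F *ᵥ x)) := by positivity
    refine (le_mul_of_one_le_right hac h1).trans ?_
    simp only [V]
    rw [mul_left_comm, Finset.mul_sum]
    refine mul_le_mul_of_nonneg_left (Finset.sum_le_sum fun i _ => ?_) (Real.exp_nonneg _)
    rw [mul_left_comm]
    refine mul_le_mul_of_nonneg_left ?_ (hw0 i)
    rw [add_mul, mul_assoc c, mulVec_dotProduct_self_eq_sum, Finset.sum_mul]
    refine add_le_add le_rfl (mul_le_mul_of_nonneg_left (Finset.sum_le_sum fun j _ => ?_) hc)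
    rw [mul_assoc]
    exact mul_le_mul_of_nonneg_left (mul_exp_le_add (sq_nonneg _) (sq_nonneg _)) (hf0 j)

end Gaussian

/-! ### Bayes optimality of linear estimates under a Gaussian prior. -/

section Bayes

variable {N m ν : ℕ}

/-- The linear functional `(x, y) ↦ a ⬝ᵥ x + b ⬝ᵥ y`. -/
noncomputable def pairCLM (a : Fin N → ℝ) (b : Fin m → ℝ) :
    ((Fin N → ℝ) × (Fin m → ℝ)) →L[ℝ] ℝ :=
  (dotProductCLM a).comp (ContinuousLinearMap.fst ℝ _ _) +
    (dotProductCLM b).comp (ContinuousLinearMap.snd ℝ _ _)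

@[simp]
theorem pairCLM_apply (a : Fin N → ℝ) (b : Fin m → ℝ) (z : (Fin N → ℝ) × (Fin m → ℝ)) :
    pairCLM a b z = a ⬝ᵥ z.1 + b ⬝ᵥ z.2 := rfl

theorem memLp_pairCLM (a : Fin N → ℝ) (b : Fin m → ℝ) :
    MemLp (pairCLM a b) 2 ((stdNormal N).prod (stdNormal m)) :=
  IsGaussian.memLp_dual _ _ 2 (by simp)

theorem integrable_dotProduct_stdNormal {n : ℕ} (a : Fin n → ℝ) :
    Integrable (fun x => a ⬝ᵥ x) (stdNormal n) :=
  (memLp_dotProduct_stdNormal a).integrable one_le_two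

theorem integrable_mul_dotProduct_stdNormal {n : ℕ} (a b : Fin n → ℝ) :
    Integrable (fun x => (a ⬝ᵥ x) * (b ⬝ᵥ x)) (stdNormal n) :=
  (memLp_dotProduct_stdNormal a).integrable_mul (memLp_dotProduct_stdNormal b)

theorem integral_pairCLM (a : Fin N → ℝ) (b : Fin m → ℝ) :
    ∫ z, pairCLM a b z ∂((stdNormal N).prod (stdNormal m)) = 0 := by
  simp only [pairCLM_apply]
  rw [integral_add ((integrable_dotProduct_stdNormal a).comp_fst _)
    ((integrable_dotProduct_stdNormal b).comp_snd _),
    integral_fun_fst (f := fun x => a ⬝ᵥ x), integral_fun_snd (f := fun x => b ⬝ᵥ x),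
    integral_dotProduct_stdNormal, integral_dotProduct_stdNormal]
  simp

theorem integral_pairCLM_mul (a a' : Fin N → ℝ) (b b' : Fin m → ℝ) :
    ∫ z, pairCLM a b z * pairCLM a' b' z ∂((stdNormal N).prod (stdNormal m)) =
      a ⬝ᵥ a' + b ⬝ᵥ b' := by
  have h1 : Integrable (fun z : (Fin N → ℝ) × (Fin m → ℝ) => (a ⬝ᵥ z.1) * (a' ⬝ᵥ z.1))
      ((stdNormal N).prod (stdNormal m)) := (integrable_mul_dotProduct_stdNormal a a').comp_fst _
  have h2 : Integrable (fun z : (Fin N → ℝ) × (Fin m → ℝ) => (b ⬝ᵥ z.2) * (b' ⬝ᵥ z.2))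
      ((stdNormal N).prod (stdNormal m)) := (integrable_mul_dotProduct_stdNormal b b').comp_snd _
  have h3 : ∀ (c : Fin N → ℝ) (d : Fin m → ℝ),
      Integrable (fun z : (Fin N → ℝ) × (Fin m → ℝ) => (c ⬝ᵥ z.1) * (d ⬝ᵥ z.2))
      ((stdNormal N).prod (stdNormal m)) := fun c d =>
    (integrable_dotProduct_stdNormal c).mul_prod (integrable_dotProduct_stdNormal d)
  have h4 : ∀ (c : Fin N → ℝ) (d : Fin m → ℝ),
      ∫ z : (Fin N → ℝ) × (Fin m → ℝ), (c ⬝ᵥ z.1) * (d ⬝ᵥ z.2)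
      ∂((stdNormal N).prod (stdNormal m)) = 0 := fun c d => by
    rw [integral_prod_mul (fun x => c ⬝ᵥ x) (fun x => d ⬝ᵥ x), integral_dotProduct_stdNormal,
      zero_mul]
  have h5 : ∀ z : (Fin N → ℝ) × (Fin m → ℝ), pairCLM a b z * pairCLM a' b' z =
      ((a ⬝ᵥ z.1) * (a' ⬝ᵥ z.1) + (b ⬝ᵥ z.2) * (b' ⬝ᵥ z.2)) +
      ((a ⬝ᵥ z.1) * (b' ⬝ᵥ z.2) + (a' ⬝ᵥ z.1) * (b ⬝ᵥ z.2)) := fun z => by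
    simp only [pairCLM_apply]
    ring
  have h6 : Integrable (fun z : (Fin N → ℝ) × (Fin m → ℝ) =>
      (a ⬝ᵥ z.1) * (a' ⬝ᵥ z.1) + (b ⬝ᵥ z.2) * (b' ⬝ᵥ z.2))
      ((stdNormal N).prod (stdNormal m)) := h1.add h2
  have h7 : Integrable (fun z : (Fin N → ℝ) × (Fin m → ℝ) =>
      (a ⬝ᵥ z.1) * (b' ⬝ᵥ z.2) + (a' ⬝ᵥ z.1) * (b ⬝ᵥ z.2))
      ((stdNormal N).prod (stdNormal m)) := (h3 a b').add (h3 a' b)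
  simp only [h5]
  rw [integral_add h6 h7, integral_add h1 h2,
    integral_add (h3 a b') (h3 a' b), h4, h4,
    integral_fun_fst (f := fun x => (a ⬝ᵥ x) * (a' ⬝ᵥ x)),
    integral_fun_snd (f := fun x => (b ⬝ᵥ x) * (b' ⬝ᵥ x)),
    integral_mul_dotProduct_stdNormal, integral_mul_dotProduct_stdNormal]
  simp

/-- This equation says that the residual `B x - Hᵀ ω` is uncorrelated with `ω`. It is solvable
because `A Q Aᵀ + σ² I ≻ 0`. -/
theorem exists_normal_equation (A : Matrix (Fin m) (Fin N) ℝ) (B : Matrix (Fin ν) (Fin N) ℝ)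
    {σ : ℝ} (hσ : 0 < σ) {Q : Matrix (Fin N) (Fin N) ℝ} (hQ : Q.PosSemidef) :
    ∃ H : Matrix (Fin m) (Fin ν) ℝ, (B - Hᵀ * A) * Q * Aᵀ = σ ^ 2 • Hᵀ := by
  have hG : (A * Q * Aᵀ + σ ^ 2 • (1 : Matrix (Fin m) (Fin m) ℝ)).PosDef :=
    (PosDef.one.smul (by positivity : 0 < σ ^ 2)).posSemidef_add (hQ.mul_mul_transpose A)
  set G := A * Q * Aᵀ + σ ^ 2 • (1 : Matrix (Fin m) (Fin m) ℝ) with hG_def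
  refine ⟨(B * Q * Aᵀ * G⁻¹)ᵀ, ?_⟩
  rw [transpose_transpose]
  set W := B * Q * Aᵀ * G⁻¹ with hW
  have h1 : W * G = B * Q * Aᵀ := by
    rw [hW, Matrix.mul_assoc, nonsing_inv_mul _ ((isUnit_iff_isUnit_det _).1 hG.isUnit),
      Matrix.mul_one]
  rw [Matrix.sub_mul, Matrix.sub_mul, ← h1, hG_def, Matrix.mul_add, Matrix.mul_smul,
    Matrix.mul_one]
  simp only [Matrix.mul_assoc]
  abel

theorem row_dotProduct_row_eq {p q n : ℕ} (D : Matrix (Fin p) (Fin n) ℝ)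
    (E : Matrix (Fin q) (Fin n) ℝ) (i : Fin p) (j : Fin q) :
    D i ⬝ᵥ E j = (D * Eᵀ) i j := by
  simp [mul_apply, dotProduct]

/-- With `x = C ζ`, the residual of the optimal linear estimate and the observation are jointly
Gaussian and uncorrelated, hence independent. The error of `w` is a function of the observation
minus the centered residual, so the cross term vanishes and the residual's second moment,
`linearCost`, remains as a lower bound. -/
theorem exists_linearCost_le_bayesRisk (A : Matrix (Fin m) (Fin N) ℝ)
    (B : Matrix (Fin ν) (Fin N) ℝ) {σ : ℝ} (hσ : 0 < σ) (C : Matrix (Fin N) (Fin N) ℝ)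
    {w : (Fin m → ℝ) → (Fin ν → ℝ)} (hw : Measurable w) {M : ℝ} (hM : ∀ ω i, |w ω i| ≤ M) :
    ∃ H : Matrix (Fin m) (Fin ν) ℝ, ENNReal.ofReal (linearCost A B σ (C * Cᵀ) H) ≤
      ∫⁻ ζ, meanSqError A B σ w (C *ᵥ ζ) ∂(stdNormal N) := by
  obtain ⟨H, hH⟩ := exists_normal_equation A B hσ (posSemidef_mul_transpose_self C)
  refine ⟨H, ?_⟩
  set μ := (stdNormal N).prod (stdNormal m) with hμ
  set E := B - Hᵀ * A with hE
  let obs : Fin m → ((Fin N → ℝ) × (Fin m → ℝ)) →L[ℝ] ℝ := fun i =>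
    pairCLM ((A * C) i) ((σ • (1 : Matrix (Fin m) (Fin m) ℝ)) i)
  let res : Fin ν → ((Fin N → ℝ) × (Fin m → ℝ)) →L[ℝ] ℝ := fun j =>
    pairCLM ((E * C) j) ((-σ • Hᵀ) j)
  have hobs : ∀ z, (fun i => obs i z) = A *ᵥ (C *ᵥ z.1) + σ • z.2 := by
    intro z
    ext i
    simp only [obs, pairCLM_apply, mulVec_mulVec, Pi.add_apply]
    change ((A * C) *ᵥ z.1) i + ((σ • (1 : Matrix (Fin m) (Fin m) ℝ)) *ᵥ z.2) i = _
    simp [smul_mulVec]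
  have hres : ∀ z, (fun j => res j z) = B *ᵥ (C *ᵥ z.1) - Hᵀ *ᵥ (fun i => obs i z) := by
    intro z
    rw [hobs]
    ext j
    simp only [res, pairCLM_apply]
    change ((E * C) *ᵥ z.1) j + ((-σ • Hᵀ) *ᵥ z.2) j = _
    simp only [hE, ← mulVec_mulVec, sub_mulVec, smul_mulVec, mulVec_add, mulVec_smul, neg_smul,
      neg_mulVec, Pi.sub_apply, Pi.add_apply, Pi.neg_apply, Pi.smul_apply, smul_eq_mul]
    ring
  have hgauss : HasGaussianLaw (fun z => (fun j => res j z, fun i => obs i z)) μ :=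
    (IsGaussian.hasGaussianLaw_id (μ := μ)).map_fun
      ((ContinuousLinearMap.pi res).prod (ContinuousLinearMap.pi obs))
  have hcov : ∀ j i, cov[fun z => res j z, fun z => obs i z; μ] = 0 := by
    intro j i
    have h1 : ∫ z, res j z ∂μ = 0 := integral_pairCLM _ _
    have h2 : ∫ z, res j z * obs i z ∂μ = _ := integral_pairCLM_mul _ _ _ _
    refine (covariance_eq_sub (memLp_pairCLM _ _) (memLp_pairCLM _ _)).trans ?_
    change (∫ z, res j z * obs i z ∂μ) - (∫ z, res j z ∂μ) * ∫ z, obs i z ∂μ = 0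
    rw [h1, h2, zero_mul, sub_zero, row_dotProduct_row_eq, row_dotProduct_row_eq, transpose_mul,
      ← Matrix.mul_assoc, Matrix.mul_assoc E, hH]
    simp [sq]
    ring
  have hind : IndepFun (fun z j => res j z) (fun z i => obs i z) μ :=
    hgauss.indepFun_of_covariance_eval hcov
  let u : (Fin m → ℝ) → Fin ν → ℝ := fun ω j => w ω j - (Hᵀ *ᵥ ω) j
  have hmeas : ∀ j, Measurable fun ω => (Hᵀ *ᵥ ω) j := fun j => by
    unfold mulVec dotProduct
    fun_prop
  have hu : ∀ j, Measurable fun ω => u ω j := fun j => (by fun_prop : Measurable fun ω => w ω j).sub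
    (hmeas j)
  have hobsm : Measurable fun z : (Fin N → ℝ) × (Fin m → ℝ) => fun i => obs i z := by fun_prop
  have hresL : ∀ j, MemLp (fun z => res j z) 2 μ := fun j => memLp_pairCLM _ _
  -- Boundedness of `w` is what makes the expansion of the square integrable term by term.
  have huL : ∀ j, MemLp (fun z => u (fun i => obs i z) j) 2 μ := by
    intro j
    refine MemLp.sub (MemLp.of_bound ?_ M (Filter.Eventually.of_forall fun z => hM _ j)) ?_
    · exact ((by fun_prop : Measurable fun ω => w ω j).comp hobsm).aestronglyMeasurable
    · simp only [mulVec, dotProduct]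
      exact memLp_finsetSum _ fun i _ => (memLp_pairCLM _ _).const_mul _
  have hcross : ∀ j, ∫ z, u (fun i => obs i z) j * res j z ∂μ = 0 := by
    intro j
    have h1 : IndepFun (fun z => u (fun i => obs i z) j) (fun z => res j z) μ :=
      hind.symm.comp (hu j) (measurable_pi_apply j)
    rw [h1.integral_fun_mul_eq_mul_integral (huL j).aestronglyMeasurable
      (hresL j).aestronglyMeasurable]
    have h2 : ∫ z, res j z ∂μ = 0 := integral_pairCLM _ _
    rw [h2, mul_zero]
  let g : (Fin N → ℝ) × (Fin m → ℝ) → ℝ := fun z =>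
    ∑ j, (u (fun i => obs i z) j - res j z) ^ 2
  have hg1 : ∀ j, Integrable (fun z => (u (fun i => obs i z) j - res j z) ^ 2) μ := fun j =>
    ((huL j).sub (hresL j)).integrable_sq
  have hg : Integrable g μ := integrable_finsetSum _ fun j _ => hg1 j
  have hgeq : ∀ z, g z = ∑ i, (w (A *ᵥ (C *ᵥ z.1) + σ • z.2) i - (B *ᵥ (C *ᵥ z.1)) i) ^ 2 := by
    intro z
    refine Finset.sum_congr rfl fun j _ => ?_
    have := congrFun (hres z) j
    rw [this, ← hobs z]
    simp only [u, Pi.sub_apply]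
    ring
  have hcost : linearCost A B σ (C * Cᵀ) H ≤ ∫ z, g z ∂μ := by
    simp only [g]
    rw [integral_finsetSum _ fun j _ => hg1 j]
    have h1 : ∀ j, (E * C) j ⬝ᵥ (E * C) j + (-σ • Hᵀ) j ⬝ᵥ (-σ • Hᵀ) j ≤
        ∫ z, (u (fun i => obs i z) j - res j z) ^ 2 ∂μ := by
      intro j
      have h2 : ∀ z, (u (fun i => obs i z) j - res j z) ^ 2 =
          u (fun i => obs i z) j ^ 2 - 2 * (u (fun i => obs i z) j * res j z) +
            res j z * res j z := fun z => by ring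
      have i1 := (huL j).integrable_sq
      have i2 : Integrable (fun z => 2 * (u (fun i => obs i z) j * res j z)) μ :=
        ((huL j).integrable_mul (hresL j)).const_mul 2
      have i3 : Integrable (fun z => res j z * res j z) μ := (hresL j).integrable_mul (hresL j)
      have i4 : Integrable (fun z => u (fun i => obs i z) j ^ 2 -
          2 * (u (fun i => obs i z) j * res j z)) μ := i1.sub i2
      simp only [h2]
      rw [integral_add i4 i3, integral_sub i1 i2, integral_const_mul, hcross]
      have h3 : ∫ z, res j z * res j z ∂μ = _ := integral_pairCLM_mul _ _ _ _
      have h4 : 0 ≤ ∫ z, u (fun i => obs i z) j ^ 2 ∂μ := integral_nonneg fun z => sq_nonneg _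
      rw [h3]
      linarith
    refine le_trans (le_of_eq ?_) (Finset.sum_le_sum fun j _ => h1 j)
    rw [Finset.sum_add_distrib, ← trace_mul_transpose_eq_sum, ← trace_mul_transpose_eq_sum,
      linearCost, ← hE]
    simp only [transpose_mul, Matrix.mul_assoc, transpose_smul, transpose_transpose, smul_mul,
       Matrix.mul_smul, trace_smul,
      smul_eq_mul]
    ring
  refine (ENNReal.ofReal_le_ofReal hcost).trans ?_
  rw [ofReal_integral_eq_lintegral_ofReal hg
    (Filter.Eventually.of_forall fun z => Finset.sum_nonneg fun j _ => sq_nonneg _), hμ,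
    lintegral_prod _ (by rw [← hμ]; exact hg.aemeasurable.ennreal_ofReal)]
  refine lintegral_mono fun ζ => le_of_eq ?_
  unfold meanSqError
  refine lintegral_congr fun ξ => ?_
  rw [hgeq]

end Bayes

/-! ### Risk of linear estimates, and the lower bound for arbitrary estimates. -/

section Risk

variable {N m ν K : ℕ} {A : Matrix (Fin m) (Fin N) ℝ} {B : Matrix (Fin ν) (Fin N) ℝ}
  {S : Matrix (Fin N) (Fin N) ℝ} {σ : ℝ} {Sk : Fin K → Matrix (Fin N) (Fin N) ℝ}
  {T : Set (Fin K → ℝ)}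

theorem integrable_mulVec_dotProduct_self {p n : ℕ} (D : Matrix (Fin p) (Fin n) ℝ) :
    Integrable (fun x => (D *ᵥ x) ⬝ᵥ (D *ᵥ x)) (stdNormal n) :=
  integrable_finsetSum _ fun i _ => integrable_mul_dotProduct_stdNormal (D i) (D i)

theorem integral_mulVec_dotProduct_self {p n : ℕ} (D : Matrix (Fin p) (Fin n) ℝ) :
    ∫ x, (D *ᵥ x) ⬝ᵥ (D *ᵥ x) ∂(stdNormal n) = (D * Dᵀ).trace := by
  rw [trace_mul_transpose_eq_sum]
  have h : ∫ x, ∑ i, (D i ⬝ᵥ x) * (D i ⬝ᵥ x) ∂(stdNormal n) = ∑ i, D i ⬝ᵥ D i := by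
    rw [integral_finsetSum _ fun i _ => integrable_mul_dotProduct_stdNormal (D i) (D i)]
    exact Finset.sum_congr rfl fun i _ => integral_mul_dotProduct_stdNormal _ _
  exact h

theorem Matrix.PosSemidef.exists_quadForm_eq {n : ℕ} {M : Matrix (Fin n) (Fin n) ℝ}
    (hM : M.PosSemidef) (C : Matrix (Fin n) (Fin n) ℝ) :
    ∃ D : Matrix (Fin n) (Fin n) ℝ, (D * Dᵀ).trace = (C * Cᵀ * M).trace ∧
      ∀ x, (C *ᵥ x) ⬝ᵥ (M *ᵥ (C *ᵥ x)) = (D *ᵥ x) ⬝ᵥ (D *ᵥ x) := by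
  obtain ⟨G, rfl⟩ := hM.exists_eq_mul_transpose
  refine ⟨Gᵀ * C, ?_, fun x => ?_⟩
  · rw [transpose_mul, transpose_transpose, ← Matrix.mul_assoc, trace_mul_comm,
      Matrix.mul_assoc Gᵀ, ← Matrix.mul_assoc G, trace_mul_comm]
  · rw [← mulVec_mulVec x Gᵀ C, dotProduct_mulVec_self, transpose_transpose]

theorem linearEstimate_meanSqError (A : Matrix (Fin m) (Fin N) ℝ) (B : Matrix (Fin ν) (Fin N) ℝ)
    (σ : ℝ) (H : Matrix (Fin m) (Fin ν) ℝ) (y : Fin N → ℝ) :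
    meanSqError A B σ (linearEstimate H) y =
      ENNReal.ofReal (((B - Hᵀ * A) *ᵥ y) ⬝ᵥ ((B - Hᵀ * A) *ᵥ y) +
        σ ^ 2 * (Hᵀ * H).trace) := by
  have h : ∀ (ξ : Fin m → ℝ) (i : Fin ν),
      (linearEstimate H (A *ᵥ y + σ • ξ) i - (B *ᵥ y) i) ^ 2 =
      ((B - Hᵀ * A) *ᵥ y) i ^ 2 - (2 * σ * ((B - Hᵀ * A) *ᵥ y) i) * (Hᵀ i ⬝ᵥ ξ) +
        σ ^ 2 * (Hᵀ i ⬝ᵥ ξ) ^ 2 := by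
    intro ξ i
    have h1 : linearEstimate H (A *ᵥ y + σ • ξ) i =
        ((Hᵀ * A) *ᵥ y) i + σ * (Hᵀ i ⬝ᵥ ξ) := by
      rw [linearEstimate, mulVec_add, mulVec_smul, mulVec_mulVec]
      rfl
    rw [h1, sub_mulVec, Pi.sub_apply]
    ring
  have i1 : ∀ i : Fin ν, Integrable (fun ξ => (2 * σ * ((B - Hᵀ * A) *ᵥ y) i) * (Hᵀ i ⬝ᵥ ξ))
      (stdNormal m) := fun i => (integrable_dotProduct_stdNormal _).const_mul _
  have i2 : ∀ i : Fin ν, Integrable (fun ξ => ((B - Hᵀ * A) *ᵥ y) i ^ 2 -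
      (2 * σ * ((B - Hᵀ * A) *ᵥ y) i) * (Hᵀ i ⬝ᵥ ξ)) (stdNormal m) :=
    fun i => (integrable_const _).sub (i1 i)
  have i3 : ∀ i : Fin ν, Integrable (fun ξ => σ ^ 2 * (Hᵀ i ⬝ᵥ ξ) ^ 2) (stdNormal m) :=
    fun i => (memLp_dotProduct_stdNormal _).integrable_sq.const_mul _
  have i4 : ∀ i : Fin ν, Integrable (fun ξ =>
      (linearEstimate H (A *ᵥ y + σ • ξ) i - (B *ᵥ y) i) ^ 2) (stdNormal m) := fun i => by
    simp only [h]
    exact (i2 i).add (i3 i)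
  rw [meanSqError, ← ofReal_integral_eq_lintegral_ofReal (integrable_finsetSum _ fun i _ => i4 i)
    (Filter.Eventually.of_forall fun ξ => Finset.sum_nonneg fun i _ => sq_nonneg _),
    integral_finsetSum _ fun i _ => i4 i]
  congr 1
  have h2 : ∀ i : Fin ν, ∫ ξ, (linearEstimate H (A *ᵥ y + σ • ξ) i - (B *ᵥ y) i) ^ 2 ∂(stdNormal m) =
      ((B - Hᵀ * A) *ᵥ y) i * ((B - Hᵀ * A) *ᵥ y) i + σ ^ 2 * (Hᵀ i ⬝ᵥ Hᵀ i) := by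
    intro i
    simp only [h]
    rw [integral_add (i2 i) (i3 i), integral_sub (integrable_const _) (i1 i), integral_const_mul,
      integral_const_mul, integral_dotProduct_stdNormal, integral_sq_dotProduct_stdNormal]
    simp [sq]
  simp only [h2, Finset.sum_add_distrib, ← Finset.mul_sum]
  rw [← trace_mul_transpose_eq_sum, transpose_transpose]
  rfl

theorem DesignFeasible.meanSqError_le (hX : IsEllitopicData Sk T) (hS : S.PosSemidef) {τ : ℝ}
    {H : Matrix (Fin m) (Fin ν) ℝ} {lam : Fin K → ℝ}
    (h : DesignFeasible A B S σ Sk T τ H lam) {y : Fin N → ℝ} {t : Fin K → ℝ} (ht : t ∈ T)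
    (hy : ∀ k, y ⬝ᵥ (Sk k *ᵥ y) ≤ t k) :
    meanSqError A B σ (linearEstimate H) y ≤ ENNReal.ofReal (τ * (1 + y ⬝ᵥ (S *ᵥ y))) := by
  obtain ⟨h1, h2, h3⟩ := (designFeasible_iff hX hS).1 h
  rw [linearEstimate_meanSqError]
  refine ENNReal.ofReal_le_ofReal ?_
  have h4 : ∑ k, lam k * (y ⬝ᵥ (Sk k *ᵥ y)) ≤ lam ⬝ᵥ t :=
    Finset.sum_le_sum fun k _ => mul_le_mul_of_nonneg_left (hy k) (h3 k)
  linarith [h1 y, h2 t ht]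

theorem trace_le_Mstar_sq (hX : IsEllitopicData Sk T) (B : Matrix (Fin ν) (Fin N) ℝ)
    {Q : Matrix (Fin N) (Fin N) ℝ} (hQ : Q.PosSemidef) {t : Fin K → ℝ} (ht : t ∈ T)
    (h : ∀ k, (Q * Sk k).trace ≤ t k) : (B * Q * Bᵀ).trace ≤ Mstar B Sk T ^ 2 :=
  (hX.isGreatest_Mstar B).2 ⟨Q, ⟨hQ, t, ht, h⟩, rfl⟩

theorem mulVec_dotProduct_le_Mstar_sq (hX : IsEllitopicData Sk T) (B : Matrix (Fin ν) (Fin N) ℝ)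
    {y : Fin N → ℝ} {t : Fin K → ℝ} (ht : t ∈ T) (hy : ∀ k, y ⬝ᵥ (Sk k *ᵥ y) ≤ t k) :
    (B *ᵥ y) ⬝ᵥ (B *ᵥ y) ≤ Mstar B Sk T ^ 2 := by
  have h := trace_le_Mstar_sq hX B (posSemidef_vecMulVec y) ht fun k => by
    rw [trace_vecMulVec_mul]
    exact hy k
  rwa [trace_mul_cycle, trace_mul_comm, trace_vecMulVec_mul, ← dotProduct_mulVec_self] at h

/-- Integrates the error over the prior `𝒩(0, δ Q)`. The Bayesian risk is at least `δ τ (1 + Tr(Q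
S))`. It is at most the risk bound averaged over the prior plus one tail majorant for each
constraint. -/
theorem mul_value_le_of_bounded (hσ : 0 < σ) (hX : IsEllitopicData Sk T) (hS : S.PosSemidef)
    {Q : Matrix (Fin N) (Fin N) ℝ} (hQ : Q.PosSemidef) {t : Fin K → ℝ} (ht : t ∈ T)
    (hQt : ∀ k, (Q * Sk k).trace ≤ t k) {τ : ℝ}
    (hlf : ∀ H : Matrix (Fin m) (Fin ν) ℝ, τ * (1 + (Q * S).trace) ≤ linearCost A B σ Q H)
    {w : (Fin m → ℝ) → (Fin ν → ℝ)} (hw : Measurable w)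
    (hwM : ∀ ω, w ω ⬝ᵥ w ω ≤ Mstar B Sk T ^ 2) {R : ℝ} (hR : 0 ≤ R)
    (hrisk : ∀ (y : Fin N → ℝ), (∀ k, y ⬝ᵥ (Sk k *ᵥ y) ≤ t k) →
      meanSqError A B σ w y ≤ ENNReal.ofReal (R * (1 + y ⬝ᵥ (S *ᵥ y))))
    {δ : ℝ} (hδ : 0 < δ) (hδ1 : δ ≤ 1) :
    δ * τ ≤ R + K * (Real.exp (-(1 / (3 * δ))) *
      (Real.sqrt 3 * (2 * Mstar B Sk T ^ 2 + 12 * δ * Mstar B Sk T ^ 2))) := by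
  obtain ⟨C, rfl⟩ := hQ.exists_eq_mul_transpose
  set M := Mstar B Sk T with hM
  have hsδ : Real.sqrt δ * Real.sqrt δ = δ := Real.mul_self_sqrt hδ.le
  have hwb : ∀ ω i, |w ω i| ≤ |M| := by
    intro ω i
    refine sq_le_sq.1 (le_trans ?_ (hwM ω))
    rw [sq]
    exact Finset.single_le_sum (f := fun i => w ω i * w ω i) (fun i _ => mul_self_nonneg _)
      (Finset.mem_univ i)
  -- For `Q = C Cᵀ`, the vector `√δ C ζ` with `ζ` standard normal has law `𝒩(0, δ Q)`.
  obtain ⟨H, hH⟩ := exists_linearCost_le_bayesRisk A B hσ (Real.sqrt δ • C) hw hwb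
  have hCC : (Real.sqrt δ • C) * (Real.sqrt δ • C)ᵀ = δ • (C * Cᵀ) := by
    rw [transpose_smul, smul_mul, Matrix.mul_smul, smul_smul, hsδ]
  rw [hCC] at hH
  have hquad : ∀ (M' : Matrix (Fin N) (Fin N) ℝ) (ζ : Fin N → ℝ),
      ((Real.sqrt δ • C) *ᵥ ζ) ⬝ᵥ (M' *ᵥ ((Real.sqrt δ • C) *ᵥ ζ)) =
      δ * ((C *ᵥ ζ) ⬝ᵥ (M' *ᵥ (C *ᵥ ζ))) := by
    intro M' ζ
    rw [smul_mulVec, mulVec_smul, smul_dotProduct, dotProduct_smul, smul_eq_mul, smul_eq_mul,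
      ← mul_assoc, hsδ]
  choose D hDtr hDq using fun k => (hX.posSemidef k).exists_quadForm_eq C
  obtain ⟨G, hGtr, hGq⟩ := hS.exists_quadForm_eq C
  have hM2 : 0 ≤ M ^ 2 := sq_nonneg M
  choose V hVi hVint hV using fun k => exists_tail_majorant (D k) (B * C) (t := t k) (δ := δ)
    (a := 2 * M ^ 2) (c := 2 * δ) hδ (by positivity) (by positivity)
    ((hDtr k).trans_le (hQt k))
  have hBC : (B * C * (B * C)ᵀ).trace ≤ M ^ 2 := by
    have := trace_le_Mstar_sq hX B hQ ht hQt
    rwa [transpose_mul, ← Matrix.mul_assoc, Matrix.mul_assoc B C]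
  set q := (C * Cᵀ * S).trace with hq
  have hq0 : 0 ≤ q := hQ.trace_mul_nonneg hS
  let W : (Fin N → ℝ) → ℝ := fun ζ => R * (1 + δ * ((G *ᵥ ζ) ⬝ᵥ (G *ᵥ ζ))) + ∑ k, V k ζ
  have hpoint : ∀ ζ, meanSqError A B σ w ((Real.sqrt δ • C) *ᵥ ζ) ≤ ENNReal.ofReal (W ζ) := by
    intro ζ
    have hG0 : 0 ≤ (G *ᵥ ζ) ⬝ᵥ (G *ᵥ ζ) := dotProduct_self_nonneg_of_real _
    by_cases hgood : ∀ k, ((Real.sqrt δ • C) *ᵥ ζ) ⬝ᵥ (Sk k *ᵥ ((Real.sqrt δ • C) *ᵥ ζ)) ≤ t k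
    · refine (hrisk _ hgood).trans (ENNReal.ofReal_le_ofReal ?_)
      rw [hquad, hGq]
      exact le_add_of_nonneg_right (Finset.sum_nonneg fun k _ => (hV k ζ).1)
    · push Not at hgood
      -- A single violated constraint suffices: its majorant dominates `2 M² + 2 ‖B x‖²`, and the
      -- other terms of `W` are nonnegative.
      obtain ⟨k, hk⟩ := hgood
      rw [hquad, hDq] at hk
      have h1 := (hV k ζ).2 hk
      have h2 : V k ζ ≤ W ζ := by
        have h3 := Finset.single_le_sum (f := fun k => V k ζ) (fun k _ => (hV k ζ).1)
          (Finset.mem_univ k)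
        have h4 : 0 ≤ R * (1 + δ * ((G *ᵥ ζ) ⬝ᵥ (G *ᵥ ζ))) := by positivity
        simp only [W]
        linarith
      have h5 : δ * (((B * C) *ᵥ ζ) ⬝ᵥ ((B * C) *ᵥ ζ)) =
          (B *ᵥ ((Real.sqrt δ • C) *ᵥ ζ)) ⬝ᵥ (B *ᵥ ((Real.sqrt δ • C) *ᵥ ζ)) := by
        rw [smul_mulVec, mulVec_smul, smul_dotProduct, dotProduct_smul, smul_eq_mul, smul_eq_mul,
          ← mul_assoc, hsδ, mulVec_mulVec]
      unfold meanSqError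
      calc _ ≤ ∫⁻ _, ENNReal.ofReal (W ζ) ∂(stdNormal m) := by
            refine lintegral_mono fun ξ => ENNReal.ofReal_le_ofReal (le_trans ?_ (h1.trans h2))
            have h6 := hwM (A *ᵥ ((Real.sqrt δ • C) *ᵥ ζ) + σ • ξ)
            rw [mul_assoc 2 δ, h5]
            set a := w (A *ᵥ ((Real.sqrt δ • C) *ᵥ ζ) + σ • ξ)
            set b := B *ᵥ ((Real.sqrt δ • C) *ᵥ ζ)
            have h7 : ∑ i, (a i - b i) ^ 2 ≤ 2 * (a ⬝ᵥ a) + 2 * (b ⬝ᵥ b) := by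
              simp only [dotProduct, Finset.mul_sum, ← Finset.sum_add_distrib]
              exact Finset.sum_le_sum fun i _ => by nlinarith [sq_nonneg (a i + b i)]
            linarith
        _ = _ := by simp
  have iG : Integrable (fun ζ => δ * ((G *ᵥ ζ) ⬝ᵥ (G *ᵥ ζ))) (stdNormal N) :=
    (integrable_mulVec_dotProduct_self G).const_mul δ
  have i1 : Integrable (fun ζ => R * (1 + δ * ((G *ᵥ ζ) ⬝ᵥ (G *ᵥ ζ)))) (stdNormal N) :=
    ((integrable_const 1).add iG).const_mul R
  have i2 : Integrable (fun ζ => ∑ k, V k ζ) (stdNormal N) :=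
    integrable_finsetSum _ fun k _ => hVi k
  have hW0 : ∀ ζ, 0 ≤ W ζ := fun ζ => by
    have hG0 : 0 ≤ (G *ᵥ ζ) ⬝ᵥ (G *ᵥ ζ) := dotProduct_self_nonneg_of_real _
    have := Finset.sum_nonneg fun k (_ : k ∈ Finset.univ) => (hV k ζ).1
    positivity
  have hWint : ∫ ζ, W ζ ∂(stdNormal N) = R * (1 + δ * q) + ∑ k, ∫ ζ, V k ζ ∂(stdNormal N) := by
    simp only [W]
    rw [integral_add i1 i2, integral_finsetSum _ fun k _ => hVi k, integral_const_mul,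
      integral_add (integrable_const 1) iG, integral_const_mul, integral_mulVec_dotProduct_self,
      hGtr]
    simp
  have hmain : ENNReal.ofReal (linearCost A B σ (δ • (C * Cᵀ)) H) ≤
      ENNReal.ofReal (∫ ζ, W ζ ∂(stdNormal N)) := by
    have iW : Integrable W (stdNormal N) := i1.add i2
    rw [ofReal_integral_eq_lintegral_ofReal iW (Filter.Eventually.of_forall hW0)]
    exact hH.trans (lintegral_mono hpoint)
  rw [ENNReal.ofReal_le_ofReal_iff (integral_nonneg hW0), hWint] at hmain
  set ε := Real.exp (-(1 / (3 * δ))) * (Real.sqrt 3 * (2 * M ^ 2 + 12 * δ * M ^ 2)) with hε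
  have hε0 : 0 ≤ ε := by positivity
  have hVle : ∀ k, ∫ ζ, V k ζ ∂(stdNormal N) ≤ ε := by
    intro k
    refine (hVint k).trans (mul_le_mul_of_nonneg_left (mul_le_mul_of_nonneg_left ?_
      (Real.sqrt_nonneg _)) (Real.exp_nonneg _))
    have := mul_le_mul_of_nonneg_left hBC (by positivity : 0 ≤ 12 * δ)
    linarith
  have hsumV : ∑ k, ∫ ζ, V k ζ ∂(stdNormal N) ≤ K * ε := by
    refine (Finset.sum_le_sum fun k _ => hVle k).trans ?_
    simp
  have h1 := linearCost_smul_ge (A := A) (B := B) (σ := σ) (C * Cᵀ) H hδ1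
  have h2 := mul_le_mul_of_nonneg_left (hlf H) hδ.le
  -- The averaged weight is `1 + δ q` on the right and `1 + q` on the left; enlarging the right side
  -- to `1 + q` lets it cancel.
  have h3 : δ * τ * (1 + q) ≤ (R + K * ε) * (1 + q) := by
    have h4 : R * (δ * q) ≤ R * q := by
      refine mul_le_mul_of_nonneg_left ?_ hR
      exact mul_le_of_le_one_left hq0 hδ1
    have h5 : 0 ≤ K * ε * q := by positivity
    nlinarith
  exact le_of_mul_le_mul_right h3 (by positivity)

/-- Metric projection onto the ball of radius `M`, which does not increase the distance to points of
the ball. -/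
theorem exists_bounded_estimate {w : (Fin m → ℝ) → (Fin ν → ℝ)} (hw : Measurable w) {M : ℝ}
    (hM : 0 ≤ M) :
    ∃ w' : (Fin m → ℝ) → (Fin ν → ℝ), Measurable w' ∧ (∀ ω, w' ω ⬝ᵥ w' ω ≤ M ^ 2) ∧
      ∀ (ω : Fin m → ℝ) (b : Fin ν → ℝ), b ⬝ᵥ b ≤ M ^ 2 →
        ∑ i, (w' ω i - b i) ^ 2 ≤ ∑ i, (w ω i - b i) ^ 2 := by
  classical
  have hs : Measurable fun ω => w ω ⬝ᵥ w ω := by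
    unfold dotProduct
    fun_prop
  let f : (Fin m → ℝ) → ℝ := fun ω =>
    if w ω ⬝ᵥ w ω ≤ M ^ 2 then 1 else M / Real.sqrt (w ω ⬝ᵥ w ω)
  have hf : Measurable f := Measurable.ite (measurableSet_le hs measurable_const)
    measurable_const (by fun_prop)
  refine ⟨fun ω => f ω • w ω, hf.smul hw, fun ω => ?_, fun ω b hb => ?_⟩
  · by_cases h : w ω ⬝ᵥ w ω ≤ M ^ 2
    · simp [f, h]
    · simp only [f, if_neg h]
      push Not at h
      have hpos : 0 < w ω ⬝ᵥ w ω := (sq_nonneg M).trans_lt h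
      rw [smul_dotProduct, dotProduct_smul, smul_eq_mul, smul_eq_mul, ← mul_assoc, div_mul_div_comm,
        Real.mul_self_sqrt hpos.le, div_mul_cancel₀ _ hpos.ne', sq]
  · have hexp : ∀ a : Fin ν → ℝ, ∑ i, (a i - b i) ^ 2 = a ⬝ᵥ a - 2 * (a ⬝ᵥ b) + b ⬝ᵥ b := by
      intro a
      simp only [dotProduct, Finset.mul_sum, ← Finset.sum_add_distrib, ← Finset.sum_sub_distrib]
      exact Finset.sum_congr rfl fun i _ => by ring
    rw [hexp, hexp]
    by_cases h : w ω ⬝ᵥ w ω ≤ M ^ 2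
    · simp [f, h]
    · simp only [f, if_neg h]
      push Not at h
      set a := w ω
      have hpos : 0 < a ⬝ᵥ a := (sq_nonneg M).trans_lt h
      set s := Real.sqrt (a ⬝ᵥ a) with hs_def
      have hss : a ⬝ᵥ a = s ^ 2 := (Real.sq_sqrt hpos.le).symm
      have hspos : 0 < s := Real.sqrt_pos.2 hpos
      have hMs : M < s := by
        rw [hss] at h
        exact lt_of_pow_lt_pow_left₀ 2 hspos.le h
      have hcs : a ⬝ᵥ b ≤ s * M := by
        have h1 : (a ⬝ᵥ b) ^ 2 ≤ (a ⬝ᵥ a) * (b ⬝ᵥ b) := by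
          have := Finset.sum_mul_sq_le_sq_mul_sq Finset.univ a b
          simpa [dotProduct, sq] using this
        refine abs_le_of_sq_le_sq' ?_ (by positivity) |>.2
        rw [mul_pow, ← hss]
        exact h1.trans (mul_le_mul_of_nonneg_left hb hpos.le)
      set c := M / s with hc
      have hcM : M = c * s := (div_mul_cancel₀ _ hspos.ne').symm
      have hc1 : c < 1 := (div_lt_one hspos).2 hMs
      rw [smul_dotProduct, dotProduct_smul, smul_eq_mul, smul_eq_mul, smul_dotProduct, smul_eq_mul,
        hss]
      rw [hcM] at hcs
      -- The decrease of the squared distance is twice this quantity plus the one in `h3`.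
      have h2 : 0 ≤ (1 - c) * (c * s ^ 2 - a ⬝ᵥ b) :=
        mul_nonneg (by linarith) (by linarith)
      have h3 : 0 ≤ (1 - c) ^ 2 * s ^ 2 := by positivity
      linarith

theorem mul_value_le (hσ : 0 < σ) (hX : IsEllitopicData Sk T) (hS : S.PosSemidef) {τ : ℝ}
    (hopt : ∀ (τ' : ℝ) (H' : Matrix (Fin m) (Fin ν) ℝ) (lam' : Fin K → ℝ),
      DesignFeasible A B S σ Sk T τ' H' lam' → τ ≤ τ')
    {w : (Fin m → ℝ) → (Fin ν → ℝ)} (hw : Measurable w) {R : ℝ} (hR : 0 ≤ R)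
    (hrisk : ∀ (y : Fin N → ℝ), ∀ t ∈ T, (∀ k, y ⬝ᵥ (Sk k *ᵥ y) ≤ t k) →
      meanSqError A B σ w y ≤ ENNReal.ofReal (R * (1 + y ⬝ᵥ (S *ᵥ y))))
    {δ : ℝ} (hδ : 0 < δ) (hδ1 : δ ≤ 1) :
    δ * τ ≤ R + K * (Real.exp (-(1 / (3 * δ))) *
      (Real.sqrt 3 * (2 * Mstar B Sk T ^ 2 + 12 * δ * Mstar B Sk T ^ 2))) := by
  obtain ⟨Q, hQ, ⟨t, ht, hQt⟩, hlf⟩ := exists_leastFavorable hX hS hopt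
  obtain ⟨w', hw', hbd, hle⟩ := exists_bounded_estimate hw (Real.sqrt_nonneg _ : 0 ≤ Mstar B Sk T)
  refine mul_value_le_of_bounded hσ hX hS hQ ht hQt hlf hw' hbd hR (fun y hy => ?_) hδ hδ1
  refine le_trans ?_ (hrisk y t ht hy)
  exact lintegral_mono fun ξ => ENNReal.ofReal_le_ofReal
    (hle _ _ (mulVec_dotProduct_le_Mstar_sq hX B ht hy))

end Risk

/-! ### Passage to the minimax risk and choice of `δ`. -/

section Minimax

variable {n N m ν K : ℕ} {A : Matrix (Fin m) (Fin n) ℝ} {B : Matrix (Fin ν) (Fin n) ℝ}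
  {S : Matrix (Fin n) (Fin n) ℝ} {σ : ℝ} {P : Matrix (Fin n) (Fin N) ℝ}
  {Sk : Fin K → Matrix (Fin N) (Fin N) ℝ} {T : Set (Fin K → ℝ)}

theorem forall_mem_ellitope_meanSqError_le_iff (w : (Fin m → ℝ) → (Fin ν → ℝ)) (R : ℝ) :
    (∀ x ∈ ellitope P Sk T,
      meanSqError A B σ w x ≤ ENNReal.ofReal (R * (1 + x ⬝ᵥ (S *ᵥ x)))) ↔
    ∀ (y : Fin N → ℝ), ∀ t ∈ T, (∀ k, y ⬝ᵥ (Sk k *ᵥ y) ≤ t k) →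
      meanSqError (A * P) (B * P) σ w y ≤
        ENNReal.ofReal (R * (1 + y ⬝ᵥ ((Pᵀ * S * P) *ᵥ y))) := by
  have h1 : ∀ y, meanSqError A B σ w (P *ᵥ y) = meanSqError (A * P) (B * P) σ w y := fun y => by
    simp only [meanSqError, mulVec_mulVec]
  have h2 : ∀ y, (P *ᵥ y) ⬝ᵥ (S *ᵥ (P *ᵥ y)) = y ⬝ᵥ ((Pᵀ * S * P) *ᵥ y) := fun y => by
    rw [Matrix.mul_assoc, ← mulVec_mulVec y Pᵀ, ← mulVec_mulVec y S, dotProduct_mulVec y,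
      vecMul_transpose]
  constructor
  · intro h y t ht hy
    rw [← h1, ← h2]
    exact h _ ⟨y, t, ht, rfl, hy⟩
  · rintro h x ⟨y, t, ht, rfl, hy⟩
    rw [h1, h2]
    exact h y t ht hy

theorem riskS_le {X : Set (Fin n → ℝ)} {w : (Fin m → ℝ) → (Fin ν → ℝ)} {R : ℝ} (hR : 0 ≤ R)
    (h : ∀ x ∈ X, meanSqError A B σ w x ≤ ENNReal.ofReal (R * (1 + x ⬝ᵥ (S *ᵥ x)))) :
    riskS A B S σ X w ≤ ENNReal.ofReal (Real.sqrt R) :=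
  iInf₂_le_of_le R ⟨hR, h⟩ le_rfl

theorem riskSOpt_le {X : Set (Fin n → ℝ)} {w : (Fin m → ℝ) → (Fin ν → ℝ)} (hw : Measurable w) :
    riskSOpt A B S σ X ≤ riskS A B S σ X w :=
  iInf₂_le_of_le w hw le_rfl

theorem DesignFeasible.riskS_le (hS : S.PosSemidef) (hX : IsEllitopicData Sk T) {τ : ℝ}
    {H : Matrix (Fin m) (Fin ν) ℝ} {lam : Fin K → ℝ}
    (h : DesignFeasible (A * P) (B * P) (Pᵀ * S * P) σ Sk T τ H lam) :
    riskS A B S σ (ellitope P Sk T) (linearEstimate H) ≤ ENNReal.ofReal (Real.sqrt τ) := by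
  have hS' : (Pᵀ * S * P).PosSemidef := by simpa using hS.mul_mul_transpose Pᵀ
  exact _root_.riskS_le (h.value_nonneg hX hS')
    ((forall_mem_ellitope_meanSqError_le_iff _ _).2 fun y t ht hy =>
      h.meanSqError_le hX hS' ht hy)

theorem riskSOpt_le_Mstar (hS : S.PosSemidef) (hX : IsEllitopicData Sk T) :
    riskSOpt A B S σ (ellitope P Sk T) ≤ ENNReal.ofReal (Mstar (B * P) Sk T) := by
  have hS' : (Pᵀ * S * P).PosSemidef := by simpa using hS.mul_mul_transpose Pᵀ
  have hM : 0 ≤ Mstar (B * P) Sk T := Real.sqrt_nonneg _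
  refine (riskSOpt_le (w := fun _ => 0) measurable_const).trans ?_
  rw [← Real.sqrt_sq hM]
  refine riskS_le (sq_nonneg _) ((forall_mem_ellitope_meanSqError_le_iff _ _).2
    fun y t ht hy => ?_)
  have h1 : meanSqError (A * P) (B * P) σ (fun _ => 0) y =
      ENNReal.ofReal (((B * P) *ᵥ y) ⬝ᵥ ((B * P) *ᵥ y)) := by
    simp [meanSqError, dotProduct, sq]
  rw [h1]
  refine ENNReal.ofReal_le_ofReal ((mulVec_dotProduct_le_Mstar_sq hX _ ht hy).trans ?_)
  exact le_mul_of_one_le_right (sq_nonneg _) (by linarith [hS'.quadForm_nonneg y])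

theorem mul_value_le_riskSOpt_sq (hσ : 0 < σ) (hS : S.PosSemidef) (hX : IsEllitopicData Sk T)
    {τ : ℝ} (hopt : ∀ (τ' : ℝ) (H' : Matrix (Fin m) (Fin ν) ℝ) (lam' : Fin K → ℝ),
      DesignFeasible (A * P) (B * P) (Pᵀ * S * P) σ Sk T τ' H' lam' → τ ≤ τ')
    {δ : ℝ} (hδ : 0 < δ) (hδ1 : δ ≤ 1) :
    δ * τ ≤ (riskSOpt A B S σ (ellitope P Sk T)).toReal ^ 2 +
      K * (Real.exp (-(1 / (3 * δ))) * (Real.sqrt 3 *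
        (2 * Mstar (B * P) Sk T ^ 2 + 12 * δ * Mstar (B * P) Sk T ^ 2))) := by
  have hS' : (Pᵀ * S * P).PosSemidef := by simpa using hS.mul_mul_transpose Pᵀ
  set ε := K * (Real.exp (-(1 / (3 * δ))) * (Real.sqrt 3 *
        (2 * Mstar (B * P) Sk T ^ 2 + 12 * δ * Mstar (B * P) Sk T ^ 2))) with hε
  rw [← sub_le_iff_le_add]
  -- Risks are compared through square roots, so a nonpositive left side is treated apart.
  rcases le_total (δ * τ - ε) 0 with h0 | h0
  · exact h0.trans (sq_nonneg _)
  have hle : ENNReal.ofReal (Real.sqrt (δ * τ - ε)) ≤ riskSOpt A B S σ (ellitope P Sk T) := by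
    refine le_iInf₂ fun w hw => le_iInf₂ fun R hR => ?_
    refine ENNReal.ofReal_le_ofReal (Real.sqrt_le_sqrt ?_)
    rw [sub_le_iff_le_add]
    exact mul_value_le hσ hX hS' hopt hw hR.1 ((forall_mem_ellitope_meanSqError_le_iff _ _).1 hR.2)
      hδ hδ1
  have hfin : riskSOpt A B S σ (ellitope P Sk T) ≠ ⊤ :=
    ((riskSOpt_le_Mstar hS hX).trans_lt ENNReal.ofReal_lt_top).ne
  rw [ENNReal.ofReal_le_iff_le_toReal hfin] at hle
  exact Real.sqrt_le_left ENNReal.toReal_nonneg |>.1 hle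

/-- The bound `exp(-u) ≤ 2/u²` at `u = 1/(3δ)` makes the tail quadratic in `δ`, against the linear
`δ τ`. -/
theorem exists_delta_tail_lt {K : ℕ} {τ M : ℝ} (hτ : 0 < τ) :
    ∃ δ : ℝ, 0 < δ ∧ δ ≤ 1 ∧ K * (Real.exp (-(1 / (3 * δ))) *
      (Real.sqrt 3 * (2 * M ^ 2 + 12 * δ * M ^ 2))) < δ * τ := by
  -- `252 = 18 · 14`: the factor `18` from the bound on the exponential, `14` from `2 + 12 δ ≤ 14`.
  set G : ℝ := 252 * (K * (Real.sqrt 3 * M ^ 2)) with hG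
  have hG0 : 0 ≤ G := by positivity
  refine ⟨τ / (τ + G + 1), by positivity, (div_le_one (by positivity)).2 (by linarith), ?_⟩
  set δ := τ / (τ + G + 1) with hδ
  have hδ0 : 0 < δ := by positivity
  have hδ1 : δ ≤ 1 := (div_le_one (by positivity)).2 (by linarith)
  have hδmul : δ * (τ + G + 1) = τ := div_mul_cancel₀ _ (by positivity)
  have hexp : Real.exp (-(1 / (3 * δ))) ≤ 18 * δ ^ 2 := by
    rw [Real.exp_neg, inv_le_comm₀ (Real.exp_pos _) (by positivity)]
    have h := Real.quadratic_le_exp_of_nonneg (x := 1 / (3 * δ)) (by positivity)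
    refine le_trans ?_ h
    have h2 : (18 * δ ^ 2)⁻¹ = (1 / (3 * δ)) ^ 2 / 2 := by
      field_simp
      norm_num
    have h3 : 0 ≤ 1 / (3 * δ) := by positivity
    linarith
  have hM : 2 * M ^ 2 + 12 * δ * M ^ 2 ≤ 14 * M ^ 2 := by nlinarith [sq_nonneg M]
  calc K * (Real.exp (-(1 / (3 * δ))) * (Real.sqrt 3 * (2 * M ^ 2 + 12 * δ * M ^ 2)))
      ≤ K * (18 * δ ^ 2 * (Real.sqrt 3 * (14 * M ^ 2))) := by gcongr
    _ = δ * (G * δ) := by rw [hG]; ring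
    _ < δ * τ := by
        refine mul_lt_mul_of_pos_left ?_ hδ0
        nlinarith

theorem two_le_log_eight : 2 ≤ Real.log 8 := by
  have h : Real.log 8 = 3 * Real.log 2 := by
    rw [show (8 : ℝ) = 2 ^ 3 by norm_num, Real.log_pow]
    norm_num
  linarith [Real.log_two_gt_d9]

/-- At `δ = 1/(3L)` the exponential equals `R / (8 K M²)`. As `L ≥ ln 8 ≥ 2`, one has `2 + 12 δ ≤
4`, so the tail is at most `(4√3/8) R ≤ R`; then `δ τ ≤ 2 R` is the claim. -/
theorem value_le_of_forall_delta {K : ℕ} (hK : 0 < K) {τ M R : ℝ} (hR : 0 < R) (hRM : R ≤ M ^ 2)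
    (h : ∀ δ : ℝ, 0 < δ → δ ≤ 1 → δ * τ ≤ R + K * (Real.exp (-(1 / (3 * δ))) *
      (Real.sqrt 3 * (2 * M ^ 2 + 12 * δ * M ^ 2)))) :
    τ ≤ 6 * Real.log (8 * K * M ^ 2 / R) * R := by
  have hM : 0 < M ^ 2 := hR.trans_le hRM
  have hK1 : (1 : ℝ) ≤ K := by exact_mod_cast hK
  set L := Real.log (8 * K * M ^ 2 / R) with hL
  have hL2 : 2 ≤ L := by
    refine two_le_log_eight.trans (Real.log_le_log (by norm_num) ?_)
    rw [le_div_iff₀ hR]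
    nlinarith
  have hexp : Real.exp (-L) = R / (8 * K * M ^ 2) := by
    rw [Real.exp_neg, hL, Real.exp_log (by positivity), inv_div]
  have h1 := h (1 / (3 * L)) (by positivity) (by
    rw [div_le_one (by positivity)]
    linarith)
  have h2 : 1 / (3 * (1 / (3 * L))) = L := by field_simp
  rw [h2, hexp] at h1
  have h3 : K * (R / (8 * K * M ^ 2) * (Real.sqrt 3 *
      (2 * M ^ 2 + 12 * (1 / (3 * L)) * M ^ 2))) =
      R * (Real.sqrt 3 * (2 + 12 * (1 / (3 * L))) / 8) := by
    have hK0 : (K : ℝ) ≠ 0 := by positivity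
    have hM0 : M ≠ 0 := fun h0 => by simp [h0] at hM
    field_simp
  rw [h3] at h1
  have hs : Real.sqrt 3 ≤ 2 := Real.sqrt_le_iff.2 ⟨by norm_num, by norm_num⟩
  have h4 : 12 * (1 / (3 * L)) ≤ 2 := by
    rw [mul_one_div, div_le_iff₀ (by positivity)]
    linarith
  have h5 : Real.sqrt 3 * (2 + 12 * (1 / (3 * L))) / 8 ≤ 1 := by
    have h6 : 0 ≤ 12 * (1 / (3 * L)) := by positivity
    nlinarith [Real.sqrt_nonneg 3]
  have h7 : 1 / (3 * L) * τ ≤ 2 * R := by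
    have := mul_le_mul_of_nonneg_left h5 hR.le
    linarith
  rw [one_div_mul_eq_div, div_le_iff₀ (by positivity)] at h7
  linarith

end Minimax

/-! ### The main theorem. -/

theorem proposition1 {n N m ν K : ℕ}
    (A : Matrix (Fin m) (Fin n) ℝ) (B : Matrix (Fin ν) (Fin n) ℝ)
    (S : Matrix (Fin n) (Fin n) ℝ) (σ : ℝ)
    (P : Matrix (Fin n) (Fin N) ℝ)
    (Sk : Fin K → Matrix (Fin N) (Fin N) ℝ) (T : Set (Fin K → ℝ))
    (hσ : 0 < σ) (hS : S.PosSemidef) (hX : IsEllitopicData Sk T) (hB : B * P ≠ 0) :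
    (∃ (τ : ℝ) (H : Matrix (Fin m) (Fin ν) ℝ) (lam : Fin K → ℝ),
      DesignOptimal (A * P) (B * P) (Pᵀ * S * P) σ Sk T τ H lam) ∧
    IsGreatest (traceValues (B * P) Sk T) (Mstar (B * P) Sk T ^ 2) ∧
    0 < riskSOpt A B S σ (ellitope P Sk T) ∧
    riskSOpt A B S σ (ellitope P Sk T) < ⊤ ∧
    ∀ (τ : ℝ) (H : Matrix (Fin m) (Fin ν) ℝ) (lam : Fin K → ℝ),
      DesignOptimal (A * P) (B * P) (Pᵀ * S * P) σ Sk T τ H lam →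
      riskS A B S σ (ellitope P Sk T) (linearEstimate H) ≤
        ENNReal.ofReal (Real.sqrt (6 * Real.log (8 * (K : ℝ) * Mstar (B * P) Sk T ^ 2 /
          (riskSOpt A B S σ (ellitope P Sk T)).toReal ^ 2))) *
        riskSOpt A B S σ (ellitope P Sk T) := by
  have hS' : (Pᵀ * S * P).PosSemidef := by simpa using hS.mul_mul_transpose Pᵀ
  have hex := exists_designOptimal (A := A * P) (B := B * P) hσ hX hS'
  have hM0 : 0 ≤ Mstar (B * P) Sk T := Real.sqrt_nonneg _
  have hleM := riskSOpt_le_Mstar (A := A) (B := B) (σ := σ) (P := P) hS hX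
  have hfin : riskSOpt A B S σ (ellitope P Sk T) < ⊤ := hleM.trans_lt ENNReal.ofReal_lt_top
  have hpos : 0 < (riskSOpt A B S σ (ellitope P Sk T)).toReal := by
    obtain ⟨τ, H, lam, hf, hopt⟩ := hex
    obtain ⟨δ, hδ, hδ1, hlt⟩ := exists_delta_tail_lt (K := K) (M := Mstar (B * P) Sk T)
      (hf.value_pos hσ hX hS' hB)
    have h := mul_value_le_riskSOpt_sq hσ hS hX hopt hδ hδ1
    refine ENNReal.toReal_nonneg.lt_of_ne' fun h0 => ?_
    rw [h0] at h
    linarith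
  refine ⟨hex, hX.isGreatest_Mstar _, (ENNReal.toReal_pos_iff.1 hpos).1, hfin,
    fun τ H lam ⟨hf, hopt⟩ => ?_⟩
  -- For `K = 0` the empty sum would be a positive definite zero matrix, leaving `B P` without
  -- columns and hence zero.
  have hK : 0 < K := by
    refine Nat.pos_of_ne_zero fun h0 => hB ?_
    subst h0
    refine Matrix.ext_of_mulVec_single fun j => ?_
    have h1 := hX.posDef_sum.dotProduct_mulVec_pos (x := Pi.single j 1) (by simp)
    simp at h1
  have hle : (riskSOpt A B S σ (ellitope P Sk T)).toReal ≤ Mstar (B * P) Sk T :=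
    ENNReal.toReal_le_of_le_ofReal hM0 hleM
  have hτ := value_le_of_forall_delta hK (pow_pos hpos 2)
    (pow_le_pow_left₀ hpos.le hle 2) fun δ hδ hδ1 => mul_value_le_riskSOpt_sq hσ hS hX hopt hδ hδ1
  refine (hf.riskS_le hS hX).trans ?_
  nth_rewrite 2 [← ENNReal.ofReal_toReal hfin.ne]
  rw [← ENNReal.ofReal_mul (Real.sqrt_nonneg _)]
  refine ENNReal.ofReal_le_ofReal ?_
  refine (Real.sqrt_le_sqrt hτ).trans ?_
  rw [Real.sqrt_mul' _ (sq_nonneg _), Real.sqrt_sq hpos.le]
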